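/- A positional scoring rule $r$ assigns to each number $m\ge 1$ of candidates a vector of natural numbers $r(m,1)\ge r(m,2)\ge\dots\ge r(m,m)$, with $r(m,1)>r(m,m)$ whenever $m\ge 2$. Suppose that $r(m,j)$ (for $1\le j\le m$) can be computed in time polynomial in $m$. The rule has polynomial scores if there is a polynomial $p$ with $r(m,j)\le p(m)$ for all $1\le j\le m$. Let $C$ be a set of $m$ candidates. In a voting profile $\mathbf T=(T_1,\dots,T_n)$ of linear orders on $C$, the score of $c\in C$ is $s(\mathbf T,c)=\sum_{i=1}^n r(m,j_i)$, where $j_i$ is the position of $c$ in $T_i$. Given a linear order $\succ$ on $C$ (the tie breaker), let $R_{\mathbf T}$ be the linear order on $C$ that ranks $a$ before $b$ if $s(\mathbf T,a)>s(\mathbf T,b)$, or if $s(\mathbf T,a)=s(\mathbf T,b)$ and $a\succ b$. A candidate is a top-$k$ winner in $\mathbf T$ if its position in $R_{\mathbf T}$ is at most $k$. For a partial profile $\mathbf P=(P_1,\dots,P_n)$ of partial orders on $C$, a candidate is a necessary top-$k$ winner if it is a top-$k$ winner in every profile $\mathbf T=(T_1,\dots,T_n)$ such that each $T_i$ is a linear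 extension of $P_i$. Theorem. For every fixed $k$ and every positional scoring rule $r$ that is computable in polynomial time as above and has polynomial scores, the following problem is solvable in (deterministic) polynomial time: given $C$, $\mathbf P$, $\succ$ and a candidate $c\in C$, decide whether $c$ is a necessary top-$k$ winner. -/

import Mathlib

namespace TopKWinners

/-! ### Positional scoring rules -/

/-- A positional scoring rule: for every number `m ≥ 1` of candidates a vector of natural numbers
`score m 1 ≥ score m 2 ≥ ⋯ ≥ score m m`, with `score m 1 > score m m` as soon as `m ≥ 2`.
Positions are numbered `1, …, m`; values of `score m j` at other `j` are never used. -/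
structure PositionalScoringRule where
  score : ℕ → ℕ → ℕ
  antitone : ∀ m i j : ℕ, 1 ≤ i → i ≤ j → j ≤ m → score m j ≤ score m i
  nontrivial : ∀ m : ℕ, 2 ≤ m → score m m < score m 1

/-- The scores are bounded by a polynomial in the number of candidates. -/
def PositionalScoringRule.HasPolynomialScores (r : PositionalScoringRule) : Prop :=
  ∃ p : Polynomial ℕ, ∀ m j : ℕ, 1 ≤ j → j ≤ m → r.score m j ≤ p.eval m

/-! ### Profiles, completions and top-`k` winners

A preference over `C` is a strict order `R`; `R a b` means that `a` is preferred to `b`. -/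

section Voting

variable {C V : Type}

/-- The position of `c` in the strict linear order `R`, the best position being `1`. -/
noncomputable def position (R : C → C → Prop) (c : C) : ℕ :=
  Set.ncard {d : C | R d c} + 1

/-- The complete voting profile `T` is a completion of the partial profile `P`: the ranking of
every voter is a linear extension of the partial order of that voter. -/
def Completes (T P : V → C → C → Prop) : Prop :=
  ∀ v : V, IsStrictTotalOrder C (T v) ∧ ∀ a b : C, P v a b → T v a b

/-- The score of the candidate `c` in the voting profile `T`. -/
noncomputable def totalScore [Fintype C] [Fintype V] (r : PositionalScoringRule)
    (T : V → C → C → Prop) (c : C) : ℕ :=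
  ∑ v : V, r.score (Fintype.card C) (position (T v) c)

/-- The linear order that sorts the candidates by their scores in `T` and then by the tie breaker
`tie`. -/
def Beats [Fintype C] [Fintype V] (r : PositionalScoringRule) (T : V → C → C → Prop)
    (tie : C → C → Prop) (a b : C) : Prop :=
  totalScore r T b < totalScore r T a ∨ (totalScore r T a = totalScore r T b ∧ tie a b)

/-- `c` is a top-`k` winner in the voting profile `T` with respect to the tie breaker `tie`. -/
def IsTopKWinner [Fintype C] [Fintype V] (r : PositionalScoringRule) (k : ℕ)
    (T : V → C → C → Prop) (tie : C → C → Prop) (c : C) : Prop :=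
  position (Beats r T tie) c ≤ k

/-- `c` is a necessary top-`k` winner for the partial profile `P`. -/
def IsNecessaryTopKWinner [Fintype C] [Fintype V] (r : PositionalScoringRule) (k : ℕ)
    (P : V → C → C → Prop) (tie : C → C → Prop) (c : C) : Prop :=
  ∀ T : V → C → C → Prop, Completes T P → IsTopKWinner r k T tie c

end Voting

/-! ### Polynomial time -/

/-- `f` is computed in time polynomial in the length of the encoded input, by a deterministic
multi-stack Turing machine all of whose alphabets are finite. -/
def PolyTimeComputable {α β A B : Type} (ea : α → List A) (eb : β → List B) (f : α → β) : Prop :=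
  ∃ M : Turing.TM2ComputableInPolyTime ea eb f, ∀ s, Finite (M.tm.Γ s)

/-- The decision problem `p` is decided in time polynomial in the length of the encoded input. -/
def PolyTimeDecidable {α A : Type} (ea : α → List A) (p : α → Prop) : Prop :=
  ∃ f : α → Bool, (∀ a, f a = true ↔ p a) ∧ PolyTimeComputable ea Computability.encodeBool f

/-- Self-delimiting unary notation: `n` ones followed by a zero. -/
def unary (n : ℕ) : List Bool := List.replicate n true ++ [false]

/-- The arguments `(m, j)`, with `1 ≤ j ≤ m`, of a scoring rule. -/
abbrev ScoreIndex : Type := {x : ℕ × ℕ // 1 ≤ x.2 ∧ x.2 ≤ x.1}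

/-- `(m, j)` is written in unary, so that the length of the code is linear in `m`. -/
def encodeScoreIndex (x : ScoreIndex) : List Bool := unary x.1.1 ++ unary x.1.2

/-- `score m j` can be computed (in binary) in time polynomial in `m`. -/
def PositionalScoringRule.IsPolyTime (r : PositionalScoringRule) : Prop :=
  PolyTimeComputable encodeScoreIndex Computability.encodeNat
    (fun x : ScoreIndex => r.score x.1.1 x.1.2)

/-! ### The necessary top-`k` winner problem -/

/-- An input: `m` candidates and `n` voters, a partial order on the candidates for each voter,
a tie breaker, which is a linear order on the candidates, and a distinguished candidate. -/
structure Instance where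
  m : ℕ
  n : ℕ
  profile : Fin n → Fin m → Fin m → Prop
  profile_order : ∀ v : Fin n, IsStrictOrder (Fin m) (profile v)
  tie : Fin m → Fin m → Prop
  tie_order : IsStrictTotalOrder (Fin m) tie
  c : Fin m

open Classical in
/-- The Boolean matrix of a binary relation, row by row. -/
noncomputable def encodeRel {m : ℕ} (R : Fin m → Fin m → Prop) : List Bool :=
  (List.finRange m).flatMap fun a => (List.finRange m).map fun b => decide (R a b)

/-- The numbers `m`, `n`, `c` in unary, then the matrix of the tie breaker, then the matrices of
the voters; the length is between `m + n` and a polynomial in `m` and `n`. -/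
noncomputable def encodeInstance (I : Instance) : List Bool :=
  unary I.m ++ unary I.n ++ unary I.c ++ encodeRel I.tie ++
    (List.finRange I.n).flatMap fun v => encodeRel (I.profile v)

/-- The necessary top-`k` winner problem for the rule `r` and a fixed `k`. -/
def NTW (r : PositionalScoringRule) (k : ℕ) (I : Instance) : Prop :=
  IsNecessaryTopKWinner r k I.profile I.tie I.c

end TopKWinners

/-! A candidate `c` fails to be a necessary top-`k` winner exactly when some completion has `k`
distinct candidates that beat `c`. As `k` is fixed, all choices of these rivals can be enumerated,
and only the scores of `k + 1` candidates matter. Whether they can reach a losing configuration is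
decided by dynamic programming over the voters: after each vote, keep the set of reachable vectors
of `k + 1` total scores. Each total is at most `n * r(m, 1)`, so polynomial scores leave
polynomially many vectors (`mem_foldl_nextTotals`, `refuted_iff`).

One vote enters only through the positions it gives to these `k + 1` candidates, so for each of at
most `m ^ (k + 1)` tuples of positions one must decide whether the partial order has a linear
extension realizing it (`exists_linear_extension_iff`). The prescribed positions confine every
candidate to a window of positions without gaps. For such windows Hall's condition needs to be
tested on intervals only (`card_le_card_biUnion_of_convex`), which gives an injective assignment of
positions. This assignment may violate the partial order, but inverted pairs can be exchanged inside
their windows, and an assignment minimizing a suitable weighted sum has no inversions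
(`exists_injective_monotone`).

The time bound is proved for actual multi-stack machines. A small structured language compiles to
`TM2` with the same step bounds (`Exec.leads`), and can call the machine that computes the scores.
The predicate `PolyTime` is closed under composition, pairing, case distinction and folds whose
states stay polynomially bounded, so the running time of the algorithm follows from the shape of its
definition. -/

namespace TopKWinners

/-! ### Compilation of structured stack programs to multi-stack Turing machines. -/

open Turing

/-! ### A structured stack language with an oracle -/

/-- The stacks of the programs: the main stack holds the data, the others are auxiliary. -/
inductive Reg
  | main | count | hold | copy
  deriving DecidableEq

instance : Fintype Reg :=
  ⟨{.main, .count, .hold, .copy}, fun r => by cases r <;> decide⟩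

section Language

variable (M : FinTM2)

/-- The stacks of the programs, followed by those of the oracle machine `M`. -/
abbrev Stack : Type := Reg ⊕ M.K

/-- The alphabet of each stack. -/
abbrev Sym : Stack M → Type
  | Sum.inl _ => Bool
  | Sum.inr k => M.Γ k

/-- The contents of all stacks. -/
abbrev Store : Type := ∀ s : Stack M, List (Sym M s)

/-- Structured stack programs that may run the machine `M`. -/
inductive Cmd : Type
  | skip : Cmd
  | push (s : Stack M) (x : Sym M s) : Cmd
  | pop (s : Stack M) : Cmd
  | seq (c d : Cmd) : Cmd
  | ite (s : Stack M) (p : Option (Sym M s) → Bool) (c d : Cmd) : Cmd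
  | loop (s : Stack M) (p : Option (Sym M s) → Bool) (c : Cmd) : Cmd
  | run : Cmd

variable {M}

/-- The store with stacks `S` for the program and `o` for the oracle. -/
def join (S : Reg → List Bool) (o : ∀ k, List (M.Γ k)) : Store M :=
  fun s => match s with
    | Sum.inl r => S r
    | Sum.inr k => o k

/-- `Exec c S S' t`: the program `c` turns the store `S` into `S'` in at most `t` steps. -/
inductive Exec : Cmd M → Store M → Store M → ℕ → Prop
  | skip (S : Store M) : Exec .skip S S 1
  | push (S : Store M) (s : Stack M) (x : Sym M s) :
      Exec (.push s x) S (Function.update S s (x :: S s)) 1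
  | pop (S : Store M) (s : Stack M) : Exec (.pop s) S (Function.update S s (S s).tail) 1
  | seq {c d : Cmd M} {S S' S'' : Store M} {t t' : ℕ} :
      Exec c S S' t → Exec d S' S'' t' → Exec (.seq c d) S S'' (t + t')
  | iteTrue {s : Stack M} {p : Option (Sym M s) → Bool} {c d : Cmd M} {S S' : Store M} {t : ℕ} :
      p (S s).head? = true → Exec c S S' t → Exec (.ite s p c d) S S' (t + 1)
  | iteFalse {s : Stack M} {p : Option (Sym M s) → Bool} {c d : Cmd M} {S S' : Store M} {t : ℕ} :
      p (S s).head? = false → Exec d S S' t → Exec (.ite s p c d) S S' (t + 1)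
  | loopTrue {s : Stack M} {p : Option (Sym M s) → Bool} {c : Cmd M} {S S' S'' : Store M}
      {t t' : ℕ} : p (S s).head? = true → Exec c S S' t → Exec (.loop s p c) S' S'' t' →
      Exec (.loop s p c) S S'' (t + t' + 1)
  | loopFalse {s : Stack M} {p : Option (Sym M s) → Bool} {c : Cmd M} {S : Store M} :
      p (S s).head? = false → Exec (.loop s p c) S S 1
  -- A run has to end with the initial internal state, as `haltList` prescribes, so every program
  -- boundary sees the same internal state.
  | run (S : Reg → List Bool) {o o' : ∀ k, List (M.Γ k)} {t : ℕ} :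
      (flip bind M.step)^[t] (some ⟨some M.main, M.initialState, o⟩) =
        some ⟨none, M.initialState, o'⟩ →
      Exec .run (join S o) (join S o') t
  | mono {c : Cmd M} {S S' : Store M} {t t' : ℕ} : Exec c S S' t → t ≤ t' → Exec c S S' t'

/-! ### Compilation to multi-stack machines -/

/-- The labels of the compiled program. -/
def Lab : Cmd M → Type
  | .skip | .push _ _ | .pop _ => Unit
  | .seq c d => Lab c ⊕ Lab d
  | .ite _ _ c d => Option (Lab c ⊕ Lab d)
  | .loop _ _ c => Option (Lab c)
  | .run => M.Λ

/-- There are finitely many labels. -/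
@[reducible]
noncomputable def labFintype : (c : Cmd M) → Fintype (Lab c)
  | .skip | .push _ _ | .pop _ => inferInstanceAs (Fintype Unit)
  | .seq c d =>
    have := labFintype c
    have := labFintype d
    inferInstanceAs (Fintype (Lab c ⊕ Lab d))
  | .ite _ _ c d =>
    have := labFintype c
    have := labFintype d
    inferInstanceAs (Fintype (Option (Lab c ⊕ Lab d)))
  | .loop _ _ c =>
    have := labFintype c
    inferInstanceAs (Fintype (Option (Lab c)))
  | .run => M.ΛFin

/-- The label where the execution starts. -/
def entry : (c : Cmd M) → Lab c
  | .skip | .push _ _ | .pop _ => ()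
  | .seq c _ => Sum.inl (entry c)
  | .ite _ _ _ _ | .loop _ _ _ => none
  | .run => M.main

/-- A statement of the oracle machine as a statement of the compiled machine. -/
def liftStmt {Λ : Type} (emb : M.Λ → Λ) (ex : Λ) :
    TM2.Stmt M.Γ M.Λ M.σ → TM2.Stmt (Sym M) Λ (Bool × M.σ)
  | .push k f q => .push (Sum.inr k) (fun v => f v.2) (liftStmt emb ex q)
  | .peek k f q => .peek (Sum.inr k) (fun v o => (v.1, f v.2 o)) (liftStmt emb ex q)
  | .pop k f q => .pop (Sum.inr k) (fun v o => (v.1, f v.2 o)) (liftStmt emb ex q)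
  | .load f q => .load (fun v => (v.1, f v.2)) (liftStmt emb ex q)
  | .branch f q q' => .branch (fun v => f v.2) (liftStmt emb ex q) (liftStmt emb ex q')
  | .goto f => .goto (fun v => emb (f v.2))
  | .halt => .goto (fun _ => ex)

/-- Test the top of a stack and jump. -/
def testStmt {Λ : Type} (s : Stack M) (p : Option (Sym M s) → Bool) (l l' : Λ) :
    TM2.Stmt (Sym M) Λ (Bool × M.σ) :=
  .peek s (fun v o => (p o, v.2)) <| .branch Prod.fst
    (.load (fun v => (false, v.2)) (.goto fun _ => l))
    (.load (fun v => (false, v.2)) (.goto fun _ => l'))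

/-- The code of a program whose labels are embedded by `emb` and that continues at `ex`. -/
def code {Λ : Type} : (c : Cmd M) → (Lab c → Λ) → Λ → Lab c → TM2.Stmt (Sym M) Λ (Bool × M.σ)
  | .skip, _, ex, _ => .goto fun _ => ex
  | .push s x, _, ex, _ => .push s (fun _ => x) (.goto fun _ => ex)
  | .pop s, _, ex, _ => .pop s (fun v _ => v) (.goto fun _ => ex)
  | .seq c d, emb, ex, l => match l with
    | Sum.inl l => code c (fun l => emb (Sum.inl l)) (emb (Sum.inr (entry d))) l
    | Sum.inr l => code d (fun l => emb (Sum.inr l)) ex l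
  | .ite s p c d, emb, ex, l => match l with
    | none => testStmt s p (emb (some (Sum.inl (entry c)))) (emb (some (Sum.inr (entry d))))
    | some (Sum.inl l) => code c (fun l => emb (some (Sum.inl l))) ex l
    | some (Sum.inr l) => code d (fun l => emb (some (Sum.inr l))) ex l
  | .loop s p c, emb, ex, l => match l with
    | none => testStmt s p (emb (some (entry c))) ex
    | some l => code c (fun l => emb (some l)) (emb none) l
  | .run, emb, ex, l => liftStmt emb ex (M.m l)

/-- The configuration of the compiled machine at a given label. -/
def cfgAt {Λ : Type} (l : Λ) (S : Store M) : TM2.Cfg (Sym M) Λ (Bool × M.σ) :=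
  ⟨some l, (false, M.initialState), S⟩

/-- A configuration of the oracle machine as a configuration of the compiled machine. -/
def liftCfg {Λ : Type} (emb : M.Λ → Λ) (ex : Λ) (S : Reg → List Bool) (x : TM2.Cfg M.Γ M.Λ M.σ) :
    TM2.Cfg (Sym M) Λ (Bool × M.σ) :=
  ⟨some (x.l.elim ex emb), (false, x.var), join S x.stk⟩

theorem update_join_inr (S : Reg → List Bool) (o : ∀ k, List (M.Γ k)) (k : M.K)
    (x : List (M.Γ k)) :
    Function.update (join S o) (Sum.inr k) x = join S (Function.update o k x) := by
  funext s
  rcases s with r | k'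
  · exact Function.update_of_ne (fun h => Sum.inl_ne_inr h) _ _
  · by_cases h : k' = k
    · subst h
      exact (Function.update_self ..).trans (Function.update_self (β := fun k => List (M.Γ k)) ..).symm
    · exact (Function.update_of_ne (fun h' => h (Sum.inr_injective h')) _ _).trans
        (Function.update_of_ne h _ _).symm

theorem stepAux_liftStmt {Λ : Type} (emb : M.Λ → Λ) (ex : Λ) (S : Reg → List Bool)
    (q : TM2.Stmt M.Γ M.Λ M.σ) (v : M.σ) (o : ∀ k, List (M.Γ k)) :
    TM2.stepAux (liftStmt emb ex q) (false, v) (join S o) =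
      liftCfg emb ex S (TM2.stepAux q v o) := by
  induction q generalizing v o with
  | push k f q ih =>
    exact (congrArg (TM2.stepAux (liftStmt emb ex q) _) (update_join_inr S o k _)).trans (ih _ _)
  | peek k f q ih => exact ih _ _
  | pop k f q ih =>
    exact (congrArg (TM2.stepAux (liftStmt emb ex q) _) (update_join_inr S o k _)).trans (ih _ _)
  | load f q ih => exact ih _ _
  | branch f q q' ih ih' =>
    simp only [liftStmt, TM2.stepAux]
    cases f v
    · exact ih' _ _
    · exact ih _ _
  | goto f => rfl
  | halt => rfl

theorem iterate_flip_bind_none {α : Type} (f : α → Option α) (n : ℕ) :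
    (flip bind f)^[n] none = none := by
  induction n with
  | zero => rfl
  | succ n ih => exact ih

/-- The embedded machine and the oracle machine move in lockstep: halting becomes a jump to the exit
label. A halted configuration has no successor, so no step is counted beyond that jump. -/
theorem iterate_liftCfg {Λ : Type} {m : Λ → TM2.Stmt (Sym M) Λ (Bool × M.σ)} {emb : M.Λ → Λ}
    {ex : Λ} (h : ∀ l, m (emb l) = liftStmt emb ex (M.m l)) (S : Reg → List Bool) (n : ℕ)
    (x y : M.Cfg) (hxy : (flip bind M.step)^[n] (some x) = some y) :
    (flip bind (TM2.step m))^[n] (some (liftCfg emb ex S x)) = some (liftCfg emb ex S y) := by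
  induction n generalizing x with
  | zero =>
    cases hxy; rfl
  | succ n ih =>
    rw [Function.iterate_succ_apply] at hxy ⊢
    obtain ⟨l, v, o⟩ := x
    cases l with
    | none =>
      have : flip bind M.step (some (⟨none, v, o⟩ : M.Cfg)) = none := rfl
      rw [this, iterate_flip_bind_none] at hxy
      cases hxy
    | some l =>
      have e : flip bind (TM2.step m) (some (liftCfg emb ex S ⟨some l, v, o⟩)) =
          some (liftCfg emb ex S (TM2.stepAux (M.m l) v o)) := by
        rw [← stepAux_liftStmt, ← h]; rfl
      rw [e]
      exact ih _ hxy

/-- `x` leads to `y` in at most `t` steps of the machine `m`. -/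
def Leads {Λ : Type} (m : Λ → TM2.Stmt (Sym M) Λ (Bool × M.σ))
    (x y : TM2.Cfg (Sym M) Λ (Bool × M.σ)) (t : ℕ) : Prop :=
  ∃ n ≤ t, (flip bind (TM2.step m))^[n] (some x) = some y

theorem Leads.trans {Λ : Type} {m : Λ → TM2.Stmt (Sym M) Λ (Bool × M.σ)}
    {x y z : TM2.Cfg (Sym M) Λ (Bool × M.σ)} {t t' : ℕ} (h : Leads m x y t) (h' : Leads m y z t') :
    Leads m x z (t + t') := by
  obtain ⟨n, hn, e⟩ := h
  obtain ⟨n', hn', e'⟩ := h'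
  exact ⟨n' + n, by omega, by rw [Function.iterate_add_apply, e, e']⟩

theorem Leads.step {Λ : Type} {m : Λ → TM2.Stmt (Sym M) Λ (Bool × M.σ)}
    {x y : TM2.Cfg (Sym M) Λ (Bool × M.σ)} (h : TM2.step m x = some y) :
    Leads m x y 1 :=
  ⟨1, le_rfl, h⟩

theorem stepAux_testStmt {Λ : Type} (s : Stack M) (p : Option (Sym M s) → Bool) (l l' : Λ)
    (S : Store M) :
    TM2.stepAux (testStmt s p l l') (false, M.initialState) S =
      cfgAt (if p (S s).head? then l else l') S := by
  simp only [testStmt, TM2.stepAux]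
  cases p (S s).head? <;> rfl

/-- The compiled program simulates the structured program. -/
theorem Exec.leads {c : Cmd M} {S S' : Store M} {t : ℕ} (h : Exec c S S' t) {Λ : Type}
    (m : Λ → TM2.Stmt (Sym M) Λ (Bool × M.σ)) (emb : Lab c → Λ) (ex : Λ)
    (hm : ∀ l, m (emb l) = code c emb ex l) :
    Leads m (cfgAt (emb (entry c)) S) (cfgAt ex S') t := by
  induction h generalizing ex with
  | skip S => exact Leads.step (by rw [cfgAt, TM2.step, hm]; rfl)
  | push S s x => exact Leads.step (by rw [cfgAt, TM2.step, hm]; rfl)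
  | pop S s => exact Leads.step (by rw [cfgAt, TM2.step, hm]; rfl)
  | seq _ _ ih ih' =>
    exact (ih (fun l => emb (Sum.inl l)) _ fun l => hm _).trans
      (ih' (fun l => emb (Sum.inr l)) _ fun l => hm _)
  | @iteTrue s p c d S S' t hp _ ih =>
    rw [add_comm]
    refine Leads.trans (Leads.step ?_) (ih (fun l => emb (some (Sum.inl l))) _ fun l => hm _)
    rw [cfgAt, TM2.step, hm]
    refine congrArg some ((stepAux_testStmt _ _ _ _ _).trans ?_)
    rw [hp]; rfl
  | @iteFalse s p c d S S' t hp _ ih =>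
    rw [add_comm]
    refine Leads.trans (Leads.step ?_) (ih (fun l => emb (some (Sum.inr l))) _ fun l => hm _)
    rw [cfgAt, TM2.step, hm]
    refine congrArg some ((stepAux_testStmt _ _ _ _ _).trans ?_)
    rw [hp]; rfl
  | @loopTrue s p c S S' S'' t t' hp _ _ ih ih' =>
    rw [add_comm]
    refine Leads.trans (Leads.step ?_) ((ih (fun l => emb (some l)) _ fun l => hm _).trans
      (ih' emb _ hm))
    rw [cfgAt, TM2.step, hm]
    refine congrArg some ((stepAux_testStmt _ _ _ _ _).trans ?_)
    rw [hp]; rfl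
  | @loopFalse s p c S hp =>
    refine Leads.step ?_
    rw [cfgAt, TM2.step, hm]
    refine congrArg some ((stepAux_testStmt _ _ _ _ _).trans ?_)
    rw [hp]; rfl
  | run S h => exact ⟨_, le_rfl, iterate_liftCfg (fun l => hm l) S _ _ _ h⟩
  | mono _ hle ih =>
    obtain ⟨n, hn, e⟩ := ih emb ex hm
    exact ⟨n, hn.trans hle, e⟩

/-- The machine that runs the program `c`, with input and output on the main stack. -/
noncomputable def machine (c : Cmd M) : FinTM2 :=
  have := M.kFin
  have := M.σFin
  have := labFintype c
  { K := Stack M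
    k₀ := Sum.inl Reg.main
    k₁ := Sum.inl Reg.main
    Γ := Sym M
    Λ := Option (Lab c)
    main := some (entry c)
    σ := Bool × M.σ
    initialState := (false, M.initialState)
    Γk₀Fin := inferInstanceAs (Fintype Bool)
    m := fun l => match l with
      | none => .halt
      | some l => code c some none l }

/-- The store with the list `l` on the main stack and nothing else. -/
def mainStore (l : List Bool) : Store M :=
  Function.update (fun _ => []) (Sum.inl Reg.main) l

theorem mainStore_of_ne (l : List Bool) {s : Stack M} (h : s ≠ Sum.inl Reg.main) :
    mainStore l s = [] :=
  Function.update_of_ne h _ _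

theorem polyTimeComputable_of_exec {α β : Type} {ea : α → List Bool} {eb : β → List Bool}
    {f : α → β} (hM : ∀ k, Finite (M.Γ k)) (c : Cmd M) (p : Polynomial ℕ)
    (h : ∀ a, Exec c (mainStore (ea a)) (mainStore (eb (f a))) (p.eval (ea a).length)) :
    PolyTimeComputable ea eb f := by
  have key : ∀ a, Nonempty (TM2OutputsInTime (machine c) (ea a) (some (eb (f a)))
      ((p + 1).eval (ea a).length)) := by
    intro a
    have hl := (h a).leads (machine c).m some none fun l => rfl
    -- One more step executes the halt at the exit label, whence the bound `p + 1`.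
    have h2 : Leads (machine c).m (cfgAt none (mainStore (eb (f a))))
        (haltList (machine c) (eb (f a))) 1 := by
      refine Leads.step (congrArg some ?_)
      refine congrArg (TM2.Cfg.mk _ _) (funext fun s => ?_)
      by_cases hs : s = Sum.inl Reg.main
      · subst hs; rfl
      · exact ((dif_neg (show ¬ s = (machine c).k₁ from hs)).trans (mainStore_of_ne _ hs).symm).symm
    obtain ⟨n, hn, e⟩ := hl.trans h2
    have h0 : initList (machine c) (ea a) = cfgAt (some (entry c)) (mainStore (ea a)) := by
      refine congrArg (TM2.Cfg.mk _ _) (funext fun s => ?_)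
      by_cases hs : s = Sum.inl Reg.main
      · subst hs; rfl
      · exact (dif_neg (show ¬ s = (machine c).k₀ from hs)).trans (mainStore_of_ne _ hs).symm
    exact ⟨⟨⟨n, (congrArg (fun x => (flip bind (machine c).step)^[n] (some x)) h0).trans e⟩,
      by simpa using hn⟩⟩
  refine ⟨{ tm := machine c, inputAlphabet := Equiv.refl _, outputAlphabet := Equiv.refl _,
            time := p + 1, outputsFun := fun a => ?_ }, ?_⟩
  · have e : ∀ l : List Bool, l.map (Equiv.refl Bool).invFun = l := fun l => List.map_id _
    exact cast (congrArg₂ (fun l l' : List Bool =>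
      TM2OutputsInTime (machine c) l (some l') ((p + 1).eval (ea a).length))
      (e (ea a)).symm (e (eb (f a))).symm) (key a).some
  · rintro (r | k)
    · exact inferInstanceAs (Finite Bool)
    · exact hM k

end Language

end TopKWinners

/-! ### Self-delimiting tree codes and the stack programs that move them. -/

namespace TopKWinners

open Turing

/-! ### Data -/

/-- Binary trees, the data of the programs. -/
inductive BinTree
  | leaf : BinTree
  | node (l r : BinTree) : BinTree

/-- The preorder code of a tree. -/
def BinTree.bits : BinTree → List Bool
  | leaf => [false]
  | node l r => true :: (l.bits ++ r.bits)

/-- Types whose elements are represented by trees. -/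
class ToTree (α : Type) where
  toTree : α → BinTree

section Data

variable {α β : Type} [ToTree α] [ToTree β]

/-- The code of an element. -/
def bits (x : α) : List Bool := (ToTree.toTree x).bits

/-- The length of the code of an element. -/
def size (x : α) : ℕ := (bits x).length

instance : ToTree Unit := ⟨fun _ => .leaf⟩

instance : ToTree Bool := ⟨fun b => if b then .node .leaf .leaf else .leaf⟩

/-- Numbers are in effect unary, with size linear in the value; this is affordable because all
scores are polynomially bounded. The code of `n` is also that of a list of `n` units, and that of a
successor is a pair code. -/
instance : ToTree ℕ := ⟨fun n => Nat.rec .leaf (fun _ t => .node .leaf t) n⟩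

instance : ToTree (α × β) := ⟨fun x => .node (ToTree.toTree x.1) (ToTree.toTree x.2)⟩

instance : ToTree (List α) :=
  ⟨fun l => List.rec .leaf (fun a _ t => .node (ToTree.toTree a) t) l⟩

/-- An element of a subtype keeps its code, so restricting a domain costs no computation. -/
instance {p : α → Prop} : ToTree {x // p x} := ⟨fun x => ToTree.toTree x.1⟩

theorem bits_pair (x : α × β) : bits x = true :: (bits x.1 ++ bits x.2) := rfl

theorem bits_cons (a : α) (l : List α) : bits (a :: l) = true :: (bits a ++ bits l) := rfl

theorem bits_subtype {p : α → Prop} (x : {x // p x}) : bits x = bits x.1 := rfl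

theorem size_bool_le (b : Bool) : size b ≤ 3 := by cases b <;> decide

theorem size_pair (x : α × β) : size x = size x.1 + size x.2 + 1 := by
  simp [size, bits_pair]

theorem size_nil : size ([] : List α) = 1 := rfl

theorem size_cons (a : α) (l : List α) : size (a :: l) = size a + size l + 1 := by
  simp [size, bits_cons]

theorem size_zero : size 0 = 1 := rfl

theorem size_succ (n : ℕ) : size (n + 1) = size n + 2 := by
  change (true :: ([false] ++ bits n)).length = _
  simp [size]

theorem size_nat (n : ℕ) : size n = 2 * n + 1 := by
  induction n with
  | zero => rfl
  | succ n ih => rw [size_succ, ih]; ring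

theorem size_list (l : List α) : size l = (l.map fun a => size a + 1).sum + 1 := by
  induction l with
  | nil => rfl
  | cons a l ih => rw [size_cons, ih, List.map_cons, List.sum_cons]; ring

theorem length_le_size (l : List α) : l.length + 1 ≤ size l := by
  induction l with
  | nil => exact le_rfl
  | cons a l ih => rw [size_cons, List.length_cons]; omega

theorem size_mem_le {l : List α} {a : α} (h : a ∈ l) : size a ≤ size l := by
  induction l with
  | nil => cases h
  | cons b l ih =>
    rw [size_cons]
    rcases List.mem_cons.1 h with rfl | h
    · omega
    · have := ih h; omega

theorem size_append (l l' : List α) : size (l ++ l') + 1 = size l + size l' := by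
  rw [size_list, size_list, size_list, List.map_append, List.sum_append]; ring

theorem size_reverse (l : List α) : size l.reverse = size l := by
  rw [size_list, size_list, List.map_reverse, List.sum_reverse]

theorem size_sublist {l l' : List α} (h : l.Sublist l') : size l ≤ size l' := by
  rw [size_list, size_list]
  exact Nat.add_le_add_right ((h.map _).sum_le_sum fun _ _ => Nat.zero_le _) 1

theorem size_list_le {l : List α} {b : ℕ} (h : ∀ a ∈ l, size a ≤ b) :
    size l ≤ l.length * (b + 1) + 1 := by
  induction l with
  | nil => simp [size_nil]
  | cons a l ih =>
    rw [size_cons, List.length_cons]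
    have h1 := h a (by simp)
    have h2 := ih fun x hx => h x (by simp [hx])
    linarith

end Data

theorem eval_mono (p : Polynomial ℕ) {m n : ℕ} (h : m ≤ n) : p.eval m ≤ p.eval n := by
  rw [Polynomial.eval_eq_sum_range, Polynomial.eval_eq_sum_range]
  gcongr

/-! ### Basic programs -/

section Programs

variable {M : FinTM2}

/-- The store with main stack `a`, counter `k`, auxiliary stacks `h` and oracle stacks `o`. -/
def st (a k : List Bool) (h : List Bool × List Bool) (o : ∀ k, List (M.Γ k)) : Store M :=
  join (fun r => match r with
    | .main => a
    | .count => k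
    | .hold => h.1
    | .copy => h.2) o

/-- The oracle stacks when the oracle is idle. -/
abbrev idle : ∀ k, List (M.Γ k) := fun _ => []

/-- The test whether the top of a stack is `true`. -/
def isTrue : Option Bool → Bool := fun x => x == some true

theorem update_join_inl (S : Reg → List Bool) (o : ∀ k, List (M.Γ k)) (r : Reg) (x : List Bool) :
    Function.update (join S o) (Sum.inl r) x = join (Function.update S r x) o := by
  funext s
  rcases s with r' | k
  · by_cases h : r' = r
    · subst h
      exact (Function.update_self ..).trans
        (Function.update_self (β := fun _ => List Bool) ..).symm
    · exact (Function.update_of_ne (fun h' => h (Sum.inl_injective h')) _ _).trans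
        (Function.update_of_ne h _ _).symm
  · exact Function.update_of_ne (fun h => Sum.inl_ne_inr h.symm) _ _

section Rules

variable (a k c e : List Bool) (h : List Bool × List Bool) (o : ∀ k, List (M.Γ k)) (x : Bool)

theorem update_main (a' : List Bool) :
    Function.update (st a k h o) (Sum.inl .main) a' = st a' k h o :=
  (update_join_inl _ _ _ _).trans (congrArg (join · o) (by funext r; cases r <;> rfl))

theorem update_count (k' : List Bool) :
    Function.update (st a k h o) (Sum.inl .count) k' = st a k' h o :=
  (update_join_inl _ _ _ _).trans (congrArg (join · o) (by funext r; cases r <;> rfl))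

theorem update_hold (c' : List Bool) :
    Function.update (st a k (c, e) o) (Sum.inl .hold) c' = st a k (c', e) o :=
  (update_join_inl _ _ _ _).trans (congrArg (join · o) (by funext r; cases r <;> rfl))

theorem update_copy (e' : List Bool) :
    Function.update (st a k (c, e) o) (Sum.inl .copy) e' = st a k (c, e') o :=
  (update_join_inl _ _ _ _).trans (congrArg (join · o) (by funext r; cases r <;> rfl))

theorem exec_push_main : Exec (.push (Sum.inl .main) x) (st a k h o) (st (x :: a) k h o) 1 :=
  update_main a k h o (x :: a) ▸ Exec.push (st a k h o) (Sum.inl .main) x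

theorem exec_push_count : Exec (.push (Sum.inl .count) x) (st a k h o) (st a (x :: k) h o) 1 :=
  update_count a k h o (x :: k) ▸ Exec.push (st a k h o) (Sum.inl .count) x

theorem exec_push_hold :
    Exec (.push (Sum.inl .hold) x) (st a k (c, e) o) (st a k (x :: c, e) o) 1 :=
  update_hold a k c e o (x :: c) ▸ Exec.push (st a k (c, e) o) (Sum.inl .hold) x

theorem exec_push_copy :
    Exec (.push (Sum.inl .copy) x) (st a k (c, e) o) (st a k (c, x :: e) o) 1 :=
  update_copy a k c e o (x :: e) ▸ Exec.push (st a k (c, e) o) (Sum.inl .copy) x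

theorem exec_pop_main : Exec (.pop (Sum.inl .main)) (st (x :: a) k h o) (st a k h o) 1 :=
  update_main (x :: a) k h o a ▸ Exec.pop (st (x :: a) k h o) (Sum.inl .main)

theorem exec_pop_count : Exec (.pop (Sum.inl .count)) (st a (x :: k) h o) (st a k h o) 1 :=
  update_count a (x :: k) h o k ▸ Exec.pop (st a (x :: k) h o) (Sum.inl .count)

theorem exec_pop_hold :
    Exec (.pop (Sum.inl .hold)) (st a k (x :: c, e) o) (st a k (c, e) o) 1 :=
  update_hold a k (x :: c) e o c ▸ Exec.pop (st a k (x :: c, e) o) (Sum.inl .hold)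

theorem exec_pop_copy :
    Exec (.pop (Sum.inl .copy)) (st a k (c, x :: e) o) (st a k (c, e) o) 1 :=
  update_copy a k c (x :: e) o e ▸ Exec.pop (st a k (c, x :: e) o) (Sum.inl .copy)

end Rules

/-- Remove a tree from the main stack, performing `body b` for every bit `b` of its code. -/
def parse (body : Bool → Cmd M) : Cmd M :=
  .seq (.push (Sum.inl .count) false) <| .seq (.push (Sum.inl .count) true) <|
    .seq (.loop (Sum.inl .count) isTrue <| .seq
      (.ite (Sum.inl .main) isTrue (.push (Sum.inl .count) true) (.pop (Sum.inl .count)))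
      (.ite (Sum.inl .main) isTrue (.seq (.pop (Sum.inl .main)) (body true))
        (.seq (.pop (Sum.inl .main)) (body false))))
    (.pop (Sum.inl .count))

theorem exec_parse {body : Bool → Cmd M} {o : ∀ k, List (M.Γ k)}
    {F : List Bool × List Bool → Bool → List Bool × List Bool}
    (hb : ∀ b a k h, Exec (body b) (st a k h o) (st a k (F h b) o) 4) (x : BinTree)
    (a k : List Bool) (h : List Bool × List Bool) :
    Exec (parse body) (st (x.bits ++ a) k h o) (st a k (x.bits.foldl F h) o)
      (9 * x.bits.length + 4) := by
  -- The counter holds one `true` for each subtree still to be read, above a `false` at the bottom: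
  -- a node adds one, a leaf removes one. The claim carries the remainder of the loop as a
  -- hypothesis, so that the two subtrees of a node chain within a single loop.
  have key : ∀ (x : BinTree) (a k h) {S' t},
      Exec (.loop (Sum.inl .count) isTrue <| .seq
        (.ite (Sum.inl .main) isTrue (.push (Sum.inl .count) true) (.pop (Sum.inl .count)))
        (.ite (Sum.inl .main) isTrue (.seq (.pop (Sum.inl .main)) (body true))
          (.seq (.pop (Sum.inl .main)) (body false)))) (st a k (x.bits.foldl F h) o) S' t →
      Exec (.loop (Sum.inl .count) isTrue <| .seq
        (.ite (Sum.inl .main) isTrue (.push (Sum.inl .count) true) (.pop (Sum.inl .count)))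
        (.ite (Sum.inl .main) isTrue (.seq (.pop (Sum.inl .main)) (body true))
          (.seq (.pop (Sum.inl .main)) (body false))))
        (st (x.bits ++ a) (true :: k) h o) S' (9 * x.bits.length + t) := by
    intro x
    induction x with
    | leaf =>
      intro a k h S' t H
      exact (Exec.loopTrue rfl (Exec.seq (Exec.iteFalse rfl (exec_pop_count ..))
        (Exec.iteFalse rfl (Exec.seq (exec_pop_main ..) (hb ..)))) H).mono
          (by simp only [BinTree.bits, List.length_singleton]; omega)
    | node l r ihl ihr =>
      intro a k h S' t H
      have e : (BinTree.node l r).bits ++ a = true :: (l.bits ++ (r.bits ++ a)) := by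
        simp [BinTree.bits]
      rw [e]
      refine (Exec.loopTrue rfl (Exec.seq (Exec.iteTrue rfl (exec_push_count ..))
        (Exec.iteTrue rfl (Exec.seq (exec_pop_main ..) (hb ..)))) (ihl _ _ _ (ihr _ _ _
          (t := t) ?_))).mono (by simp only [BinTree.bits, List.length_cons, List.length_append]; omega)
      simpa [BinTree.bits] using H
  exact (Exec.seq (exec_push_count ..) (Exec.seq (exec_push_count ..) (Exec.seq
    (key x a (false :: k) h (Exec.loopFalse rfl)) (exec_pop_count ..)))).mono (by omega)

/-- Push the bits of `l` on `h`, each one followed by a mark. -/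
def mark (h l : List Bool) : List Bool := l.foldl (fun h b => true :: b :: h) h

theorem mark_append_singleton (h l : List Bool) (b : Bool) :
    mark h (l ++ [b]) = true :: b :: mark h l := by
  simp [mark]

/-- Move a marked list from `hold` back to the main stack. -/
def unhold : Cmd M :=
  .seq (.loop (Sum.inl .hold) isTrue <| .seq (.pop (Sum.inl .hold)) <|
    .ite (Sum.inl .hold) isTrue
      (.seq (.pop (Sum.inl .hold)) (.push (Sum.inl .main) true))
      (.seq (.pop (Sum.inl .hold)) (.push (Sum.inl .main) false)))
    (.pop (Sum.inl .hold))

/-- Move a marked list from `copy` back to the main stack. -/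
def uncopy : Cmd M :=
  .seq (.loop (Sum.inl .copy) isTrue <| .seq (.pop (Sum.inl .copy)) <|
    .ite (Sum.inl .copy) isTrue
      (.seq (.pop (Sum.inl .copy)) (.push (Sum.inl .main) true))
      (.seq (.pop (Sum.inl .copy)) (.push (Sum.inl .main) false)))
    (.pop (Sum.inl .copy))

/-- A mark `true` announces a further bit, while the `false` underneath ends the block, so several
blocks can lie on one stack. Bits come back last first, hence the induction from the end of the
list. -/
theorem exec_unhold (l a k c e : List Bool) (o : ∀ k, List (M.Γ k)) :
    Exec unhold (st a k (mark (false :: c) l, e) o) (st (l ++ a) k (c, e) o)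
      (5 * l.length + 2) := by
  have key : Exec (.loop (Sum.inl .hold) isTrue <| .seq (.pop (Sum.inl .hold)) <|
      .ite (Sum.inl .hold) isTrue
        (.seq (.pop (Sum.inl .hold)) (.push (Sum.inl .main) true))
        (.seq (.pop (Sum.inl .hold)) (.push (Sum.inl .main) false)))
      (st a k (mark (false :: c) l, e) o) (st (l ++ a) k (false :: c, e) o)
        (5 * l.length + 1) := by
    induction l using List.reverseRecOn generalizing a with
    | nil => exact Exec.loopFalse rfl
    | append_singleton l b ih =>
      rw [mark_append_singleton, List.append_assoc, List.length_append]
      cases b with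
      | true =>
        exact (Exec.loopTrue rfl (Exec.seq (exec_pop_hold ..) (Exec.iteTrue rfl
          (Exec.seq (exec_pop_hold ..) (exec_push_main ..)))) (ih _)).mono
            (by rw [List.length_singleton]; omega)
      | false =>
        exact (Exec.loopTrue rfl (Exec.seq (exec_pop_hold ..) (Exec.iteFalse rfl
          (Exec.seq (exec_pop_hold ..) (exec_push_main ..)))) (ih _)).mono
            (by rw [List.length_singleton]; omega)
  exact key.seq (exec_pop_hold ..)

theorem exec_uncopy (l a k c e : List Bool) (o : ∀ k, List (M.Γ k)) :
    Exec uncopy (st a k (c, mark (false :: e) l) o) (st (l ++ a) k (c, e) o)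
      (5 * l.length + 2) := by
  have key : Exec (.loop (Sum.inl .copy) isTrue <| .seq (.pop (Sum.inl .copy)) <|
      .ite (Sum.inl .copy) isTrue
        (.seq (.pop (Sum.inl .copy)) (.push (Sum.inl .main) true))
        (.seq (.pop (Sum.inl .copy)) (.push (Sum.inl .main) false)))
      (st a k (c, mark (false :: e) l) o) (st (l ++ a) k (c, false :: e) o)
        (5 * l.length + 1) := by
    induction l using List.reverseRecOn generalizing a with
    | nil => exact Exec.loopFalse rfl
    | append_singleton l b ih =>
      rw [mark_append_singleton, List.append_assoc, List.length_append]
      cases b with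
      | true =>
        exact (Exec.loopTrue rfl (Exec.seq (exec_pop_copy ..) (Exec.iteTrue rfl
          (Exec.seq (exec_pop_copy ..) (exec_push_main ..)))) (ih _)).mono
            (by rw [List.length_singleton]; omega)
      | false =>
        exact (Exec.loopTrue rfl (Exec.seq (exec_pop_copy ..) (Exec.iteFalse rfl
          (Exec.seq (exec_pop_copy ..) (exec_push_main ..)))) (ih _)).mono
            (by rw [List.length_singleton]; omega)
  exact key.seq (exec_pop_copy ..)

/-- Remove the tree on top of the main stack. -/
def drop : Cmd M := parse fun _ => .skip

theorem exec_drop (x : BinTree) (a k : List Bool) (h : List Bool × List Bool)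
    (o : ∀ k, List (M.Γ k)) :
    Exec drop (st (x.bits ++ a) k h o) (st a k h o) (9 * x.bits.length + 4) := by
  have := exec_parse (o := o) (body := fun _ => (.skip : Cmd M)) (F := fun h _ => h)
    (fun b a k h => (Exec.skip _).mono (by omega)) x a k h
  rwa [List.foldl_fixed] at this

/-- Move the tree on top of the main stack to `hold`. -/
def hold : Cmd M :=
  .seq (.push (Sum.inl .hold) false)
    (parse fun b => .seq (.push (Sum.inl .hold) b) (.push (Sum.inl .hold) true))

theorem exec_hold (x : BinTree) (a k c e : List Bool) (o : ∀ k, List (M.Γ k)) :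
    Exec hold (st (x.bits ++ a) k (c, e) o) (st a k (mark (false :: c) x.bits, e) o)
      (9 * x.bits.length + 5) := by
  have := exec_parse (o := o)
    (body := fun b => (.seq (.push (Sum.inl .hold) b) (.push (Sum.inl .hold) true) : Cmd M))
    (F := fun h b => (true :: b :: h.1, h.2))
    (fun b a k h => ((exec_push_hold ..).seq (exec_push_hold ..)).mono (by omega)) x a k
    (false :: c, e)
  have hf : ∀ (l c : List Bool), l.foldl (fun h b => (true :: b :: h.1, h.2)) (c, e) =
      (mark c l, e) := by
    intro l
    induction l with
    | nil => intro c; rfl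
    | cons b l ih => intro c; exact ih _
  rw [hf] at this
  exact ((exec_push_hold ..).seq this).mono (by omega)

/-- Push a copy of the tree on top of the main stack on `copy`. -/
def save : Cmd M :=
  .seq (.seq (.push (Sum.inl .hold) false) (.push (Sum.inl .copy) false)) <|
  .seq (parse fun b =>
    .seq (.seq (.push (Sum.inl .hold) b) (.push (Sum.inl .hold) true))
      (.seq (.push (Sum.inl .copy) b) (.push (Sum.inl .copy) true)))
    unhold

theorem exec_save (x : BinTree) (a k c e : List Bool) (o : ∀ k, List (M.Γ k)) :
    Exec save (st (x.bits ++ a) k (c, e) o)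
      (st (x.bits ++ a) k (c, mark (false :: e) x.bits) o) (14 * x.bits.length + 8) := by
  have := exec_parse (o := o)
    (body := fun b => (.seq (.seq (.push (Sum.inl .hold) b) (.push (Sum.inl .hold) true))
      (.seq (.push (Sum.inl .copy) b) (.push (Sum.inl .copy) true)) : Cmd M))
    (F := fun h b => (true :: b :: h.1, true :: b :: h.2))
    (fun b a k h => (((exec_push_hold ..).seq (exec_push_hold ..)).seq
      ((exec_push_copy ..).seq (exec_push_copy ..)))) x a k
    (false :: c, false :: e)
  have hf : ∀ (l c e : List Bool), l.foldl (fun h b => (true :: b :: h.1, true :: b :: h.2)) (c, e) =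
      (mark c l, mark e l) := by
    intro l
    induction l with
    | nil => intro c e; rfl
    | cons b l ih => intro c e; exact ih _ _
  rw [hf] at this
  exact (((exec_push_hold ..).seq (exec_push_copy ..)).seq (this.seq (exec_unhold ..))).mono
    (by omega)

end Programs

end TopKWinners

/-! ### Closure properties of polynomial-time functions. -/

namespace TopKWinners

open Turing

/-! ### Functions computed by programs in polynomial time -/

section PolyTime

variable {M : FinTM2} {α β γ δ σ : Type} [ToTree α] [ToTree β] [ToTree γ] [ToTree δ] [ToTree σ]

variable (M) in
/-- Some program replaces `x` by `f x` on top of the main stack, in time polynomial in the size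
of `x`, and leaves everything below and all other stacks unchanged. -/
def PolyTime (f : α → β) : Prop :=
  ∃ c : Cmd M, ∃ p : Polynomial ℕ, ∀ x, size (f x) ≤ p.eval (size x) ∧ ∀ a k h,
    Exec c (st (bits x ++ a) k h idle) (st (bits (f x) ++ a) k h idle) (p.eval (size x))

namespace PolyTime

theorem size_le {f : α → β} (h : PolyTime M f) :
    ∃ p : Polynomial ℕ, ∀ x, size (f x) ≤ p.eval (size x) :=
  let ⟨_, p, hp⟩ := h
  ⟨p, fun x => (hp x).1⟩

/-- A program sees only codes, so it also computes every function that agrees with the given one on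
codes. This serves both to change types and to replace a function by an equal one. -/
theorem of_bits_eq {f : α → β} (h : PolyTime M f) {α' β' : Type} [ToTree α'] [ToTree β']
    {i : α' → α} {g : α' → β'} (hi : ∀ x, bits (i x) = bits x)
    (hg : ∀ x, bits (g x) = bits (f (i x))) : PolyTime M g := by
  obtain ⟨c, p, hp⟩ := h
  refine ⟨c, p, fun x => ?_⟩
  have := hp (i x)
  rwa [size, size, hi, ← hg] at this

protected theorem id : PolyTime M (fun x : α => x) :=
  ⟨.skip, .X + 1, fun x => ⟨by simp, fun a k h => (Exec.skip _).mono (by simp)⟩⟩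

protected theorem comp {g : β → γ} {f : α → β} (hg : PolyTime M g) (hf : PolyTime M f) :
    PolyTime M (fun x => g (f x)) := by
  obtain ⟨c, p, hp⟩ := hf
  obtain ⟨d, q, hq⟩ := hg
  refine ⟨.seq c d, p + q.comp p, fun x => ?_⟩
  rw [Polynomial.eval_add, Polynomial.eval_comp]
  have hm := eval_mono q (hp x).1
  exact ⟨((hq _).1.trans hm).trans (Nat.le_add_left _ _), fun a k h =>
    (((hp x).2 a k h).seq ((hq _).2 a k h)).mono (Nat.add_le_add_left hm _)⟩

protected theorem subtype_val {p : α → Prop} : PolyTime M (fun x : {x // p x} => x.1) :=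
  (PolyTime.id (α := α)).of_bits_eq (i := Subtype.val) (fun _ => rfl) fun _ => rfl

theorem exec_pushes (l a k : List Bool) (h : List Bool × List Bool) (o : ∀ k, List (M.Γ k)) :
    Exec (l.foldr (fun b c => .seq c (.push (Sum.inl .main) b)) .skip) (st a k h o)
      (st (l ++ a) k h o) (l.length + 1) := by
  induction l with
  | nil => exact Exec.skip _
  | cons b l ih => exact (ih.seq (exec_push_main ..)).mono (by rw [List.length_cons])

protected theorem const (y : β) : PolyTime M (fun _ : α => y) := by
  refine ⟨.seq drop ((bits y).foldr (fun b c => .seq c (.push (Sum.inl .main) b)) .skip),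
    9 * .X + Polynomial.C (size y + 5), fun x => ⟨?_, fun a k h => ?_⟩⟩
  · simp only [Polynomial.eval_add, Polynomial.eval_C]; omega
  · exact ((exec_drop ..).seq (exec_pushes ..)).mono
      (by simp only [Polynomial.eval_add, Polynomial.eval_C, Polynomial.eval_mul,
            Polynomial.eval_X, Polynomial.eval_ofNat, size, bits]; omega)

/-- The second component is computed first, since the first one lies on top in the code of a pair; a
saved copy of the input serves for the other computation. -/
protected theorem pair {f : α → β} {g : α → γ} (hf : PolyTime M f) (hg : PolyTime M g) :
    PolyTime M (fun x => (f x, g x)) := by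
  obtain ⟨c, p, hp⟩ := hf
  obtain ⟨d, q, hq⟩ := hg
  refine ⟨.seq save (.seq d (.seq uncopy (.seq c (.push (Sum.inl .main) true)))),
    19 * .X + p + q + 11, fun x => ⟨?_, fun a k h => ?_⟩⟩
  · rw [size_pair]
    have h1 := (hp x).1
    have h2 := (hq x).1
    simp only [Polynomial.eval_add, Polynomial.eval_mul,
            Polynomial.eval_X, Polynomial.eval_ofNat]
    omega
  · rw [bits_pair, List.cons_append, List.append_assoc]
    exact ((exec_save ..).seq (((hq x).2 ..).seq ((exec_uncopy ..).seq (((hp x).2 ..).seq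
      (exec_push_main ..))))).mono (by
        simp only [Polynomial.eval_add, Polynomial.eval_mul,
            Polynomial.eval_X, Polynomial.eval_ofNat, size, bits]; omega)

theorem fst_aux : PolyTime M (fun x : α × β => x.1) := by
  refine ⟨.seq (.pop (Sum.inl .main)) (.seq hold (.seq drop unhold)),
    14 * .X + 12, fun x => ⟨?_, fun a k h => ?_⟩⟩
  · rw [size_pair]
    simp only [Polynomial.eval_add, Polynomial.eval_mul,
            Polynomial.eval_X, Polynomial.eval_ofNat]
    omega
  · rw [bits_pair, List.cons_append, List.append_assoc, size_pair]
    exact ((exec_pop_main ..).seq ((exec_hold ..).seq ((exec_drop ..).seq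
      (exec_unhold ..)))).mono (by
        simp only [Polynomial.eval_add, Polynomial.eval_mul,
            Polynomial.eval_X, Polynomial.eval_ofNat, size, bits]; omega)

theorem snd_aux : PolyTime M (fun x : α × β => x.2) := by
  refine ⟨.seq (.pop (Sum.inl .main)) drop,
    9 * .X + 5, fun x => ⟨?_, fun a k h => ?_⟩⟩
  · rw [size_pair]
    simp only [Polynomial.eval_add, Polynomial.eval_mul,
            Polynomial.eval_X, Polynomial.eval_ofNat]
    omega
  · rw [bits_pair, List.cons_append, List.append_assoc, size_pair]
    exact ((exec_pop_main ..).seq (exec_drop ..)).mono (by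
        simp only [Polynomial.eval_add, Polynomial.eval_mul,
            Polynomial.eval_X, Polynomial.eval_ofNat, size, bits]; omega)

protected theorem fst {f : α → β × γ} (h : PolyTime M f) : PolyTime M (fun x => (f x).1) :=
  fst_aux.comp h

protected theorem snd {f : α → β × γ} (h : PolyTime M f) : PolyTime M (fun x => (f x).2) :=
  snd_aux.comp h

/-- The first branch need only make sense where the test succeeds, as for scores, which are
specified only at valid indices. The code of `true` has three bits and that of `false` has one,
which explains the different numbers of pops. -/
protected theorem dite {b : α → Bool} (hb : PolyTime M b) {f : {x // b x = true} → β}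
    (hf : PolyTime M f) {g : α → β} (hg : PolyTime M g) :
    PolyTime M (fun x => if h : b x = true then f ⟨x, h⟩ else g x) := by
  obtain ⟨e, r, hr⟩ := hb
  obtain ⟨c, p, hp⟩ := hf
  obtain ⟨d, q, hq⟩ := hg
  refine ⟨.seq save (.seq e (.ite (Sum.inl .main) isTrue
      (.seq (.seq (.pop (Sum.inl .main)) (.seq (.pop (Sum.inl .main)) (.pop (Sum.inl .main))))
        (.seq uncopy c))
      (.seq (.pop (Sum.inl .main)) (.seq uncopy d)))),
    19 * .X + p + q + r + 14, fun x => ⟨?_, fun a k h => ?_⟩⟩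
  · simp only [Polynomial.eval_add]
    split_ifs with hx
    · have := (hp ⟨x, hx⟩).1
      rw [show size (⟨x, hx⟩ : {x // b x = true}) = size x from rfl] at this
      omega
    · have := (hq x).1
      omega
  · have he := (hr x).2 a k (h.1, mark (false :: h.2) (bits x))
    by_cases hx : b x = true
    · beta_reduce
      rw [dif_pos hx]
      rw [hx] at he
      have hc := (hp ⟨x, hx⟩).2 a k h
      rw [show size (⟨x, hx⟩ : {x // b x = true}) = size x from rfl, bits_subtype] at hc
      exact ((exec_save ..).seq (he.seq (Exec.iteTrue rfl (((exec_pop_main ..).seq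
        ((exec_pop_main ..).seq (exec_pop_main ..))).seq ((exec_uncopy ..).seq hc))))).mono (by
          simp only [Polynomial.eval_add, Polynomial.eval_mul,
            Polynomial.eval_X, Polynomial.eval_ofNat, size, bits]; omega)
    · beta_reduce
      rw [dif_neg hx]
      rw [Bool.not_eq_true] at hx
      rw [hx] at he
      exact ((exec_save ..).seq (he.seq (Exec.iteFalse rfl ((exec_pop_main ..).seq
        ((exec_uncopy ..).seq ((hq x).2 ..)))))).mono (by
          simp only [Polynomial.eval_add, Polynomial.eval_mul,
            Polynomial.eval_X, Polynomial.eval_ofNat, size, bits]; omega)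

protected theorem ite {b : α → Bool} (hb : PolyTime M b) {f g : α → β}
    (hf : PolyTime M f) (hg : PolyTime M g) :
    PolyTime M (fun x => if b x = true then f x else g x) :=
  hb.dite (hf.comp PolyTime.subtype_val) hg

protected theorem cons {f : α → β} {g : α → List β} (hf : PolyTime M f) (hg : PolyTime M g) :
    PolyTime M (fun x => f x :: g x) :=
  (hf.pair hg).of_bits_eq (i := fun x => x) (fun _ => rfl) fun _ => rfl

protected theorem succ {f : α → ℕ} (hf : PolyTime M f) : PolyTime M (fun x => f x + 1) :=
  ((PolyTime.const ()).pair hf).of_bits_eq (i := fun x => x) (fun _ => rfl) fun _ => rfl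

/-- Case distinction on a list. -/
protected theorem list_cases {l : α → List β} (hl : PolyTime M l) {f : α → γ}
    (hf : PolyTime M f) {g : α → β → List β → γ}
    (hg : PolyTime M (fun p : α × β × List β => g p.1 p.2.1 p.2.2)) :
    PolyTime M (fun x => match l x with
      | [] => f x
      | b :: l' => g x b l') := by
  obtain ⟨e, r, hr⟩ := hl
  obtain ⟨c, p, hp⟩ := hf
  obtain ⟨d, q, hq⟩ := hg
  -- A nonempty list has the same code as the pair of its head and tail. Restoring `x` on top of it
  -- and adding a node bit therefore produces the code of `(x, b, l')`.
  refine ⟨.seq save (.seq e (.ite (Sum.inl .main) isTrue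
      (.seq uncopy (.seq (.push (Sum.inl .main) true) d))
      (.seq (.pop (Sum.inl .main)) (.seq uncopy c)))),
    19 * .X + p + q.comp (.X + r + 1) + r + 14, fun x => ?_⟩
  have he := fun a k (h : List Bool × List Bool) =>
    (hr x).2 a k (h.1, mark (false :: h.2) (bits x))
  have hs := (hr x).1
  simp only [Polynomial.eval_add, Polynomial.eval_mul, Polynomial.eval_one,
            Polynomial.eval_X, Polynomial.eval_ofNat, Polynomial.eval_comp]
  cases hx : l x with
  | nil =>
    rw [hx] at he
    refine ⟨by have := (hp x).1; simp only; omega, fun a k h => ?_⟩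
    exact ((exec_save ..).seq ((he _ _ _).seq (Exec.iteFalse rfl ((exec_pop_main ..).seq
        ((exec_uncopy ..).seq ((hp x).2 ..)))))).mono (by
          simp only [size, bits]; omega)
  | cons b l' =>
    rw [hx] at he hs
    have hq' := hq (x, b, l')
    have hm : q.eval (size (x, b, l')) ≤ q.eval (size x + r.eval (size x) + 1) := by
      refine eval_mono q ?_
      rw [size_cons] at hs
      rw [size_pair, size_pair]; dsimp only; omega
    refine ⟨by have := hq'.1; simp only at this ⊢; omega, fun a k h => ?_⟩
    have hd := hq'.2 a k h
    rw [bits_pair, List.cons_append, List.append_assoc] at hd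
    exact ((exec_save ..).seq ((he _ _ _).seq (Exec.iteTrue rfl ((exec_uncopy ..).seq
        ((exec_push_main ..).seq hd))))).mono (by
          simp only [size, bits] at hm ⊢; omega)

/-- Iteration, the number of rounds being the length of a list. -/
protected theorem iterate {i : α → σ} {l : α → List β} {f : σ → σ} (hi : PolyTime M i)
    (hl : PolyTime M l) (hf : PolyTime M f)
    (hbd : ∃ q : Polynomial ℕ, ∀ x, ∀ j ≤ (l x).length, size (f^[j] (i x)) ≤ q.eval (size x)) :
    PolyTime M (fun x => f^[(l x).length] (i x)) := by
  obtain ⟨e, r, hr⟩ := hl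
  obtain ⟨c, p, hp⟩ := hf
  obtain ⟨d, s, hs⟩ := hi
  obtain ⟨q, hq⟩ := hbd
  have count : ∀ (l : List β) (a k : List Bool) (h : List Bool × List Bool),
      Exec (.loop (Sum.inl .main) isTrue (.seq (.pop (Sum.inl .main)) (.seq drop
        (.push (Sum.inl .count) true) : Cmd M))) (st (bits l ++ a) k h idle)
        (st (false :: a) (List.replicate l.length true ++ k) h idle) (9 * size l + 1) := by
    intro l
    induction l with
    | nil => exact fun a k h => (Exec.loopFalse rfl).mono (by omega)
    | cons b l ih =>
      intro a k h
      rw [bits_cons, List.cons_append, List.append_assoc, List.length_cons, size_cons,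
        List.replicate_succ', List.append_assoc]
      exact (Exec.loopTrue rfl ((exec_pop_main ..).seq ((exec_drop ..).seq
        (exec_push_count ..))) (ih ..)).mono (by simp only [size, bits]; omega)
  -- The bound `q` on all intermediate states is essential: every round costs at most `p.eval
  -- (q.eval (size x))`, whereas composing `p` with itself once per round would not stay polynomial.
  have rounds : ∀ (x : α) (n j : ℕ) (a k : List Bool) (h : List Bool × List Bool),
      j + n = (l x).length →
      Exec (.loop (Sum.inl .count) isTrue (.seq (.pop (Sum.inl .count)) c : Cmd M))
        (st (bits (f^[j] (i x)) ++ a) (List.replicate n true ++ false :: k) h idle)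
        (st (bits (f^[(l x).length] (i x)) ++ a) (false :: k) h idle)
        (n * (p.eval (q.eval (size x)) + 2) + 1) := by
    intro x n
    induction n with
    | zero =>
      intro j a k h hj
      rw [← hj]
      exact (Exec.loopFalse rfl).mono (by omega)
    | succ n ih =>
      intro j a k h hj
      have h1 := (hp (f^[j] (i x))).2 a (List.replicate n true ++ false :: k) h
      rw [← Function.iterate_succ_apply' f] at h1
      exact (Exec.loopTrue rfl ((exec_pop_count ..).seq h1)
        (ih (j + 1) a k h (by omega))).mono (by
          have := eval_mono p (hq x j (by omega))
          nlinarith)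
  refine ⟨.seq save (.seq e (.seq (.push (Sum.inl .count) false) (.seq
      (.loop (Sum.inl .main) isTrue (.seq (.pop (Sum.inl .main)) (.seq drop
        (.push (Sum.inl .count) true))))
      (.seq (.pop (Sum.inl .main)) (.seq uncopy (.seq d (.seq
        (.loop (Sum.inl .count) isTrue (.seq (.pop (Sum.inl .count)) c))
        (.pop (Sum.inl .count))))))))),
    19 * .X + 10 * r + s + q + r * (p.comp q + 2) + 15, fun x => ⟨?_, fun a k h => ?_⟩⟩
  · have := hq x _ le_rfl
    simp only [Polynomial.eval_add]
    omega
  · refine ((exec_save ..).seq (((hr x).2 ..).seq ((exec_push_count ..).seq ((count ..).seq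
      ((exec_pop_main ..).seq ((exec_uncopy ..).seq (((hs x).2 ..).seq
      ((rounds x (l x).length 0 _ _ _ (Nat.zero_add _)).seq (exec_pop_count ..)))))))) ).mono ?_
    have h1 := (hr x).1
    have h2 := length_le_size (l x)
    have h3 : (l x).length * (p.eval (q.eval (size x)) + 2) ≤
      r.eval (size x) * (p.eval (q.eval (size x)) + 2) := Nat.mul_le_mul_right _ (by omega)
    simp only [Polynomial.eval_add, Polynomial.eval_mul, Polynomial.eval_comp,
            Polynomial.eval_X, Polynomial.eval_ofNat]
    have h4 : (ToTree.toTree x).bits.length = size x := rfl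
    have h5 : (bits x).length = size x := rfl
    omega

/-- Left folds with polynomially bounded states. -/
protected theorem foldl {s : α → σ} {l : α → List β} {g : α → σ → β → σ} (hs : PolyTime M s)
    (hl : PolyTime M l) (hg : PolyTime M (fun p : α × σ × β => g p.1 p.2.1 p.2.2))
    (hbd : ∃ q : Polynomial ℕ, ∀ x l', l' <+: l x →
      size (l'.foldl (g x) (s x)) ≤ q.eval (size x)) :
    PolyTime M (fun x => (l x).foldl (g x) (s x)) := by
  have hstep : PolyTime M (fun y : α × σ × List β => match y.2.2 with
      | [] => y
      | b :: l' => (y.1, g y.1 y.2.1 b, l')) :=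
    PolyTime.id.snd.snd.list_cases PolyTime.id
      (PolyTime.id.fst.fst.pair ((hg.comp (PolyTime.id.fst.fst.pair
        (PolyTime.id.fst.snd.fst.pair PolyTime.id.snd.fst))).pair PolyTime.id.snd.snd))
  -- The list is consumed as part of the state, so each round is a case distinction on the remaining
  -- list.
  have hit : ∀ (j : ℕ) (x : α), (fun y : α × σ × List β => match y.2.2 with
      | [] => y
      | b :: l' => (y.1, g y.1 y.2.1 b, l'))^[j] (x, s x, l x) =
        (x, ((l x).take j).foldl (g x) (s x), (l x).drop j) := by
    intro j x
    induction j with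
    | zero => rfl
    | succ j ih =>
      rw [Function.iterate_succ_apply', ih]
      rcases hd : (l x).drop j with _ | ⟨b, l'⟩
      · have h1 : (l x).length ≤ j := List.drop_eq_nil_iff.1 hd
        simp only [List.take_of_length_le h1, List.take_of_length_le (h1.trans (Nat.le_succ j)),
          List.drop_of_length_le (h1.trans (Nat.le_succ j))]
      · have h1 : j < (l x).length := by
          by_contra h
          rw [List.drop_of_length_le (by omega)] at hd
          cases hd
        rw [List.drop_eq_getElem_cons h1] at hd
        obtain ⟨h2, h3⟩ := List.cons.inj hd
        simp only [← List.take_concat_get' _ _ h1, List.foldl_append, h3, h2, List.foldl_cons,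
          List.foldl_nil]
  obtain ⟨q, hq⟩ := hbd
  obtain ⟨r, hr⟩ := hl.size_le
  have := (PolyTime.iterate (PolyTime.id.pair (hs.pair hl)) hl hstep
    ⟨.X + q + r + 2, fun x j _ => ?_⟩).snd.fst
  · refine this.of_bits_eq (i := fun x => x) (fun _ => rfl) fun x => ?_
    rw [hit, List.take_length]
  · rw [hit, size_pair, size_pair]
    have h1 := hq x _ (List.take_prefix j _)
    have h2 := size_sublist (List.drop_sublist j (l x))
    have h3 := hr x
    simp only [Polynomial.eval_add, Polynomial.eval_X, Polynomial.eval_ofNat]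
    omega

end PolyTime

end PolyTime

end TopKWinners

/-! ### Calls of the score machine, and the passage from programs back to machines. -/

namespace TopKWinners

open Turing

/-! ### Oracle calls -/

section Oracle

variable {α β : Type} {ea : α → List Bool} {eb : β → List Bool} {f : α → β}

theorem update_oracle {M : FinTM2} (a k : List Bool) (h : List Bool × List Bool)
    (o : ∀ k, List (M.Γ k)) (s : M.K) (l : List (M.Γ s)) :
    Function.update (st a k h o) (Sum.inr s) l = st a k h (Function.update o s l) :=
  update_join_inr ..

theorem exec_push_oracle {M : FinTM2} (a k : List Bool) (h : List Bool × List Bool)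
    (s : M.K) (x : M.Γ s) (l : List (M.Γ s)) :
    Exec (.push (Sum.inr s) x) (st a k h (Function.update idle s l))
      (st a k h (Function.update idle s (x :: l))) 1 := by
  have gen : ∀ o, Exec (.push (Sum.inr s) x) (st a k h o)
      (st a k h (Function.update o s (x :: o s))) 1 :=
    fun o => update_oracle a k h o s (x :: o s) ▸ Exec.push (st a k h o) (Sum.inr s) x
  have := gen (Function.update idle s l)
  rwa [Function.update_self, Function.update_idem] at this

theorem exec_pop_oracle {M : FinTM2} (a k : List Bool) (h : List Bool × List Bool)
    (s : M.K) (x : M.Γ s) (l : List (M.Γ s)) :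
    Exec (.pop (Sum.inr s)) (st a k h (Function.update idle s (x :: l)))
      (st a k h (Function.update idle s l)) 1 := by
  have gen : ∀ o, Exec (.pop (Sum.inr s)) (st a k h o)
      (st a k h (Function.update o s (o s).tail)) 1 :=
    fun o => update_oracle a k h o s (o s).tail ▸ Exec.pop (st a k h o) (Sum.inr s)
  have := gen (Function.update idle s (x :: l))
  rwa [Function.update_self, Function.update_idem] at this

theorem initList_eq (tm : FinTM2) (l : List (tm.Γ tm.k₀)) :
    initList tm l = ⟨some tm.main, tm.initialState, Function.update idle tm.k₀ l⟩ := by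
  refine congrArg (TM2.Cfg.mk _ _) (funext fun s => ?_)
  by_cases hs : s = tm.k₀
  · subst hs
    have h : Function.update (β := fun s => List (tm.Γ s)) idle tm.k₀ l tm.k₀ = l :=
      Function.update_self ..
    exact (dif_pos rfl).trans h.symm
  · have h : Function.update (β := fun s => List (tm.Γ s)) idle tm.k₀ l s = [] :=
      Function.update_of_ne hs ..
    exact (dif_neg hs).trans h.symm

theorem haltList_eq (tm : FinTM2) (l : List (tm.Γ tm.k₁)) :
    haltList tm l = ⟨none, tm.initialState, Function.update idle tm.k₁ l⟩ := by
  refine congrArg (TM2.Cfg.mk _ _) (funext fun s => ?_)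
  by_cases hs : s = tm.k₁
  · subst hs
    have h : Function.update (β := fun s => List (tm.Γ s)) idle tm.k₁ l tm.k₁ = l :=
      Function.update_self ..
    exact (dif_pos rfl).trans h.symm
  · have h : Function.update (β := fun s => List (tm.Γ s)) idle tm.k₁ l s = [] :=
      Function.update_of_ne hs ..
    exact (dif_neg hs).trans h.symm

/-- Push a Boolean on a list on top of the main stack. -/
def pushBool {M : FinTM2} : Bool → Cmd M
  | true => .seq (.push (Sum.inl .main) false) (.seq (.push (Sum.inl .main) false)
      (.seq (.push (Sum.inl .main) true) (.push (Sum.inl .main) true)))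
  | false => .seq (.push (Sum.inl .main) false) (.push (Sum.inl .main) true)

theorem exec_pushBool {M : FinTM2} (b : Bool) (r : List Bool) (a k : List Bool)
    (h : List Bool × List Bool) (o : ∀ k, List (M.Γ k)) :
    Exec (pushBool b) (st (bits r ++ a) k h o) (st (bits (b :: r) ++ a) k h o) 4 := by
  cases b with
  | true => exact (exec_push_main ..).seq ((exec_push_main ..).seq ((exec_push_main ..).seq
      (exec_push_main ..)))
  | false => exact ((exec_push_main ..).seq (exec_push_main ..)).mono (by omega)

theorem size_boolList_le (l : List Bool) : size l ≤ 4 * l.length + 1 :=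
  (size_list_le fun b _ => size_bool_le b).trans (by omega)

variable (H : TM2ComputableInPolyTime ea eb f)

/-- Move a list of Booleans from the main stack to the input stack of the oracle. -/
def feed : Cmd H.tm :=
  .seq (.loop (Sum.inl .main) isTrue (.seq (.pop (Sum.inl .main))
    (.ite (Sum.inl .main) isTrue
      (.seq (.seq (.pop (Sum.inl .main)) (.seq (.pop (Sum.inl .main)) (.pop (Sum.inl .main))))
        (.push (Sum.inr H.tm.k₀) (H.inputAlphabet.invFun true)))
      (.seq (.pop (Sum.inl .main)) (.push (Sum.inr H.tm.k₀) (H.inputAlphabet.invFun false))))))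
    (.pop (Sum.inl .main))

/-- Moving symbols from one stack to another reverses them. The same happens to the output, which is
why oracle calls are described by reversed lists on both sides. -/
theorem exec_feed (l a k : List Bool) (h : List Bool × List Bool) :
    Exec (feed H) (st (bits l ++ a) k h idle)
      (st a k h (Function.update idle H.tm.k₀ (l.reverse.map H.inputAlphabet.invFun)))
      (7 * size l) := by
  have key : ∀ (l : List Bool) (r : List (H.tm.Γ H.tm.k₀)),
      Exec (.loop (Sum.inl .main) isTrue (.seq (.pop (Sum.inl .main))
        (.ite (Sum.inl .main) isTrue
          (.seq (.seq (.pop (Sum.inl .main)) (.seq (.pop (Sum.inl .main)) (.pop (Sum.inl .main))))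
            (.push (Sum.inr H.tm.k₀) (H.inputAlphabet.invFun true)))
          (.seq (.pop (Sum.inl .main))
            (.push (Sum.inr H.tm.k₀) (H.inputAlphabet.invFun false))))))
        (st (bits l ++ a) k h (Function.update idle H.tm.k₀ r))
        (st (false :: a) k h (Function.update idle H.tm.k₀
          (l.reverse.map H.inputAlphabet.invFun ++ r))) (7 * l.length + 1) := by
    intro l
    induction l with
    | nil => exact fun r => Exec.loopFalse rfl
    | cons b l ih =>
      intro r
      rw [List.reverse_cons, List.map_append, List.append_assoc]
      cases b with
      | true =>
        exact (Exec.loopTrue rfl ((exec_pop_main ..).seq (Exec.iteTrue rfl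
          (((exec_pop_main ..).seq ((exec_pop_main ..).seq (exec_pop_main ..))).seq
            (exec_push_oracle ..)))) (ih _)).mono (by rw [List.length_cons]; omega)
      | false =>
        exact (Exec.loopTrue rfl ((exec_pop_main ..).seq (Exec.iteFalse rfl
          ((exec_pop_main ..).seq (exec_push_oracle ..)))) (ih _)).mono
            (by rw [List.length_cons]; omega)
  have h1 := key l []
  rw [Function.update_eq_self_iff.2 rfl, List.append_nil] at h1
  exact (h1.seq (exec_pop_main ..)).mono (by have := length_le_size l; omega)

/-- Move the output of the oracle to the main stack. -/
def drain : Cmd H.tm :=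
  .seq (.push (Sum.inl .main) false)
    (.loop (Sum.inr H.tm.k₁) Option.isSome
      (.ite (Sum.inr H.tm.k₁) (fun o => o.map H.outputAlphabet == some true)
        (.seq (.pop (Sum.inr H.tm.k₁)) (pushBool true))
        (.seq (.pop (Sum.inr H.tm.k₁)) (pushBool false))))

theorem exec_drain (l a k : List Bool) (h : List Bool × List Bool) :
    Exec (drain H) (st a k h (Function.update idle H.tm.k₁ (l.map H.outputAlphabet.invFun)))
      (st (bits l.reverse ++ a) k h idle) (7 * l.length + 2) := by
  have key : ∀ (l : List Bool) (r : List Bool),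
      Exec (.loop (Sum.inr H.tm.k₁) Option.isSome
          (.ite (Sum.inr H.tm.k₁) (fun o => o.map H.outputAlphabet == some true)
            (.seq (.pop (Sum.inr H.tm.k₁)) (pushBool true))
            (.seq (.pop (Sum.inr H.tm.k₁)) (pushBool false))))
        (st (bits r ++ a) k h (Function.update idle H.tm.k₁ (l.map H.outputAlphabet.invFun)))
        (st (bits (l.reverse ++ r) ++ a) k h idle) (7 * l.length + 1) := by
    intro l
    have hd : ∀ (a : List Bool) (l : List (H.tm.Γ H.tm.k₁)),
        (st a k h (Function.update idle H.tm.k₁ l) (Sum.inr H.tm.k₁)) = l :=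
      fun a l => Function.update_self ..
    induction l with
    | nil =>
      intro r
      rw [List.map_nil, Function.update_eq_self_iff.2 rfl]
      exact Exec.loopFalse rfl
    | cons b l ih =>
      intro r
      rw [List.reverse_cons, List.append_assoc, List.map_cons, List.length_cons]
      cases b with
      | true =>
        exact (Exec.loopTrue (by rw [hd]; rfl) (Exec.iteTrue (by rw [hd]; simp)
          ((exec_pop_oracle ..).seq (exec_pushBool ..))) (ih _)).mono (by omega)
      | false =>
        exact (Exec.loopTrue (by rw [hd]; rfl) (Exec.iteFalse (by rw [hd]; simp)
          ((exec_pop_oracle ..).seq (exec_pushBool ..))) (ih _)).mono (by omega)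
  have h1 := key l []
  rw [List.append_nil] at h1
  exact ((exec_push_main ..).seq h1).mono (by omega)

/-- `haltList` leaves every stack except the output empty, so once the output is drained the machine
is ready for another call. -/
theorem exec_run (x : α) (a k : List Bool) (h : List Bool × List Bool) :
    Exec (M := H.tm) .run
      (st a k h (Function.update idle H.tm.k₀ ((ea x).map H.inputAlphabet.invFun)))
      (st a k h (Function.update idle H.tm.k₁ ((eb (f x)).map H.outputAlphabet.invFun)))
      (H.time.eval (ea x).length) := by
  obtain ⟨⟨n, e⟩, hn⟩ := H.outputsFun x
  refine (Exec.run _ ?_).mono hn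
  rw [Option.map_some] at e
  rw [initList_eq, haltList_eq] at e
  exact e

/-- The function computed by the oracle machine is computed by a program. -/
theorem PolyTime.oracle [ToTree α] (h : PolyTime H.tm fun x => (ea x).reverse)
    (hbd : ∃ q : Polynomial ℕ, ∀ x, (eb (f x)).length ≤ q.eval (size x)) :
    PolyTime H.tm fun x => (eb (f x)).reverse := by
  obtain ⟨c, p, hp⟩ := h
  obtain ⟨q, hq⟩ := hbd
  refine ⟨.seq c (.seq (feed H) (.seq .run (drain H))), p + 7 * p + H.time.comp p + 7 * q + 2,
    fun x => ⟨?_, fun a k h => ?_⟩⟩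
  · have h1 := size_boolList_le (eb (f x)).reverse
    rw [List.length_reverse] at h1
    have h2 := hq x
    simp only [Polynomial.eval_add, Polynomial.eval_mul, Polynomial.eval_ofNat]
    omega
  · have h1 := exec_feed H (ea x).reverse a k h
    rw [List.reverse_reverse] at h1
    refine (((hp x).2 ..).seq (h1.seq ((exec_run H x ..).seq (exec_drain ..)))).mono ?_
    have h2 : size (ea x).reverse ≤ _ := (hp x).1
    have h3 := hq x
    have h4 : H.time.eval (ea x).length ≤ H.time.eval (p.eval (size x)) := by
      refine eval_mono _ ?_
      have := length_le_size (ea x).reverse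
      rw [List.length_reverse] at this
      omega
    simp only [Polynomial.eval_add, Polynomial.eval_mul, Polynomial.eval_ofNat,
      Polynomial.eval_comp]
    omega

end Oracle

/-! ### From programs to machines -/

section Main

variable {M : FinTM2} {α : Type} {ea : α → List Bool}

/-- Replace the raw input on the main stack by the code of a list of Booleans. -/
def readInput : Cmd M :=
  .seq (.loop (Sum.inl .main) Option.isSome (.ite (Sum.inl .main) isTrue
      (.seq (.pop (Sum.inl .main)) (.push (Sum.inl .hold) true))
      (.seq (.pop (Sum.inl .main)) (.push (Sum.inl .hold) false)))) <|
  .seq (.push (Sum.inl .main) false)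
    (.loop (Sum.inl .hold) Option.isSome (.ite (Sum.inl .hold) isTrue
      (.seq (.pop (Sum.inl .hold)) (pushBool true))
      (.seq (.pop (Sum.inl .hold)) (pushBool false))))

/-- Nothing lies below the raw input, so its end is recognized by the empty stack and no marks are
needed. The detour through `hold` makes the bits arrive last first, as needed to build a list from
its end. -/
theorem exec_readInput (l : List Bool) :
    Exec (M := M) readInput (st l [] ([], []) idle) (st (bits l) [] ([], []) idle)
      (11 * l.length + 3) := by
  have h1 : ∀ l c, Exec (M := M) (.loop (Sum.inl .main) Option.isSome
      (.ite (Sum.inl .main) isTrue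
        (.seq (.pop (Sum.inl .main)) (.push (Sum.inl .hold) true))
        (.seq (.pop (Sum.inl .main)) (.push (Sum.inl .hold) false))))
      (st l [] (c, []) idle) (st [] [] (l.reverse ++ c, []) idle) (4 * l.length + 1) := by
    intro l
    induction l with
    | nil => exact fun c => Exec.loopFalse rfl
    | cons b l ih =>
      intro c
      rw [List.reverse_cons, List.append_assoc, List.length_cons]
      cases b with
      | true =>
        exact (Exec.loopTrue rfl (Exec.iteTrue rfl ((exec_pop_main ..).seq
          (exec_push_hold ..))) (ih _)).mono (by omega)
      | false =>
        exact (Exec.loopTrue rfl (Exec.iteFalse rfl ((exec_pop_main ..).seq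
          (exec_push_hold ..))) (ih _)).mono (by omega)
  have h2 : ∀ c l, Exec (M := M) (.loop (Sum.inl .hold) Option.isSome
      (.ite (Sum.inl .hold) isTrue
        (.seq (.pop (Sum.inl .hold)) (pushBool true))
        (.seq (.pop (Sum.inl .hold)) (pushBool false))))
      (st (bits l ++ []) [] (c, []) idle) (st (bits (c.reverse ++ l)) [] ([], []) idle)
        (7 * c.length + 1) := by
    intro c
    induction c with
    | nil =>
      intro l
      rw [List.append_nil]
      exact Exec.loopFalse rfl
    | cons b c ih =>
      intro l
      rw [List.reverse_cons, List.append_assoc, List.length_cons]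
      cases b with
      | true =>
        exact (Exec.loopTrue rfl (Exec.iteTrue rfl ((exec_pop_hold ..).seq
          (exec_pushBool ..))) (ih _)).mono (by omega)
      | false =>
        exact (Exec.loopTrue rfl (Exec.iteFalse rfl ((exec_pop_hold ..).seq
          (exec_pushBool ..))) (ih _)).mono (by omega)
  have h3 := h1 l []
  have h4 := h2 l.reverse []
  rw [List.append_nil] at h3
  simp only [List.append_nil, List.reverse_reverse, List.length_reverse] at h4
  exact (h3.seq ((exec_push_main ..).seq h4)).mono (by omega)

theorem mainStore_eq (l : List Bool) : mainStore (M := M) l = st l [] ([], []) idle := by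
  funext s
  by_cases h : s = Sum.inl Reg.main
  · subst h; rfl
  · rw [mainStore_of_ne _ h]
    rcases s with r | k
    · cases r <;> first | rfl | exact absurd rfl h
    · rfl

/-- The tree code of `false` is already its output code, while the three bits for `true` have to be
replaced by one. -/
theorem PolyTime.polyTimeComputable {g : List Bool → Bool} (hg : PolyTime M g)
    (hM : ∀ k, Finite (M.Γ k)) :
    PolyTimeComputable ea Computability.encodeBool (fun a => g (ea a)) := by
  obtain ⟨c, p, hp⟩ := hg
  refine polyTimeComputable_of_exec hM (.seq readInput (.seq c (.ite (Sum.inl .main) isTrue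
    (.seq (.pop (Sum.inl .main)) (.seq (.pop (Sum.inl .main)) (.seq (.pop (Sum.inl .main))
      (.push (Sum.inl .main) true)))) .skip)))
    (11 * .X + p.comp (4 * .X + 1) + 8) fun a => ?_
  have h1 := (hp (ea a)).2 [] [] ([], [])
  have h2 := eval_mono p (size_boolList_le (ea a))
  rw [List.append_nil, List.append_nil] at h1
  simp only [Polynomial.eval_add, Polynomial.eval_mul, Polynomial.eval_ofNat,
      Polynomial.eval_comp, Polynomial.eval_X, Polynomial.eval_one]
  rw [mainStore_eq, mainStore_eq]
  cases hga : g (ea a) with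
  | true =>
    rw [hga] at h1
    exact ((exec_readInput _).seq (h1.seq (Exec.iteTrue rfl ((exec_pop_main ..).seq
      ((exec_pop_main ..).seq ((exec_pop_main ..).seq (exec_push_main ..))))))).mono (by omega)
  | false =>
    rw [hga] at h1
    exact ((exec_readInput _).seq (h1.seq (Exec.iteFalse rfl (Exec.skip _)))).mono (by omega)

end Main

end TopKWinners

/-! ### Polynomial-time Boolean, list and unary arithmetic operations. -/

namespace TopKWinners

open Turing

/-! ### A library of polynomial-time functions -/

namespace PolyTime

variable {M : FinTM2} {α β γ δ σ : Type} [ToTree α] [ToTree β] [ToTree γ] [ToTree δ] [ToTree σ]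

section Bool

variable {f g : α → Bool}

protected theorem not (hf : PolyTime M f) : PolyTime M (fun x => !f x) :=
  (hf.ite (PolyTime.const false) (PolyTime.const true)).of_bits_eq (i := fun x => x)
    (fun _ => rfl) fun x => by cases f x <;> rfl

protected theorem and (hf : PolyTime M f) (hg : PolyTime M g) : PolyTime M (fun x => f x && g x) :=
  (hf.ite hg (PolyTime.const false)).of_bits_eq (i := fun x => x)
    (fun _ => rfl) fun x => by cases f x <;> rfl

protected theorem or (hf : PolyTime M f) (hg : PolyTime M g) : PolyTime M (fun x => f x || g x) :=
  (hf.ite (PolyTime.const true) hg).of_bits_eq (i := fun x => x)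
    (fun _ => rfl) fun x => by cases f x <;> rfl

end Bool

/-- Folds over lists and booleans, with states bounded by a constant. -/
protected theorem foldl_bool {l : α → List β} {g : α → Bool → β → Bool} {s : α → Bool}
    (hs : PolyTime M s) (hl : PolyTime M l)
    (hg : PolyTime M (fun p : α × Bool × β => g p.1 p.2.1 p.2.2)) :
    PolyTime M (fun x => (l x).foldl (g x) (s x)) :=
  hs.foldl hl hg ⟨3, fun x l' _ => (size_bool_le _).trans (by simp)⟩

section List

variable {l : α → List β}

protected theorem any (hl : PolyTime M l) {p : α → β → Bool}
    (hp : PolyTime M (fun y : α × β => p y.1 y.2)) : PolyTime M (fun x => (l x).any (p x)) := by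
  have h := (PolyTime.const false).foldl_bool hl (g := fun x s b => s || p x b)
    (PolyTime.id.snd.fst.or (hp.comp (PolyTime.id.fst.pair PolyTime.id.snd.snd)))
  have e : ∀ (x : α) (l : List β) (s : Bool),
      l.foldl (fun s b => s || p x b) s = (s || l.any (p x)) := by
    intro x l
    induction l with
    | nil => simp
    | cons b l ih => intro s; rw [List.foldl_cons, ih, List.any_cons, Bool.or_assoc]
  exact h.of_bits_eq (i := fun x => x) (fun _ => rfl) fun x => by rw [e]; rfl

protected theorem all (hl : PolyTime M l) {p : α → β → Bool}
    (hp : PolyTime M (fun y : α × β => p y.1 y.2)) : PolyTime M (fun x => (l x).all (p x)) :=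
  (hl.any hp.not).not.of_bits_eq (i := fun x => x) (fun _ => rfl) fun x => by
    rw [List.all_eq_not_any_not]

protected theorem reverse (hl : PolyTime M l) : PolyTime M (fun x => (l x).reverse) := by
  obtain ⟨q, hq⟩ := hl.size_le
  have e : ∀ (l l' : List β), l.foldl (fun s b => b :: s) l' = l.reverse ++ l' := by
    intro l
    induction l with
    | nil => simp
    | cons b l ih => intro l'; rw [List.foldl_cons, ih]; simp
  refine ((PolyTime.const []).foldl hl (g := fun _ s b => b :: s)
    (PolyTime.id.snd.snd.cons PolyTime.id.snd.fst) ⟨q, fun x l' h => ?_⟩).of_bits_eq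
    (i := fun x => x) (fun _ => rfl) fun x => by rw [e, List.append_nil]
  rw [e, List.append_nil, size_reverse]
  exact (size_sublist h.sublist).trans (hq x)

/-- A list is at least as large as each of its elements, so one polynomial bounds all the values.
This supplies the state bounds for folds. -/
theorem size_of_mem (hl : PolyTime M l) {f : α → β → γ}
    (hf : PolyTime M (fun y : α × β => f y.1 y.2)) : ∃ q : Polynomial ℕ,
    ∀ x, ∀ b ∈ l x, size (f x b) ≤ q.eval (size x) := by
  obtain ⟨q, hq⟩ := hl.size_le
  obtain ⟨r, hr⟩ := hf.size_le
  refine ⟨r.comp (.X + q + 1), fun x b hb => (hr (x, b)).trans ?_⟩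
  rw [Polynomial.eval_comp]
  refine eval_mono r ?_
  rw [size_pair]
  have h1 := size_mem_le hb
  have h2 := hq x
  simp only [Polynomial.eval_add, Polynomial.eval_X, Polynomial.eval_one]
  omega

protected theorem map (hl : PolyTime M l) {f : α → β → γ}
    (hf : PolyTime M (fun y : α × β => f y.1 y.2)) : PolyTime M (fun x => (l x).map (f x)) := by
  obtain ⟨q, hq⟩ := hl.size_le
  obtain ⟨r, hr⟩ := hl.size_of_mem hf
  have e : ∀ (x : α) (l : List β) (l' : List γ),
      l.foldl (fun s b => f x b :: s) l' = (l.map (f x)).reverse ++ l' := by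
    intro x l
    induction l with
    | nil => simp
    | cons b l ih => intro l'; rw [List.foldl_cons, ih]; simp
  refine ((PolyTime.const []).foldl hl (g := fun x s b => f x b :: s)
    ((hf.comp (PolyTime.id.fst.pair PolyTime.id.snd.snd)).cons PolyTime.id.snd.fst)
    ⟨q * (r + 1) + 1, fun x l' h => ?_⟩).reverse.of_bits_eq
    (i := fun x => x) (fun _ => rfl) fun x => by rw [e, List.append_nil, List.reverse_reverse]
  rw [e, List.append_nil, size_reverse]
  refine (size_list_le (b := r.eval (size x)) fun c hc => ?_).trans ?_
  · obtain ⟨b, hb, rfl⟩ := List.mem_map.1 hc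
    exact hr x b (h.subset hb)
  · rw [List.length_map, Polynomial.eval_add, Polynomial.eval_mul, Polynomial.eval_add,
      Polynomial.eval_one]
    have h1 := length_le_size (l x)
    have h2 := h.length_le
    have h3 := hq x
    gcongr
    omega

protected theorem filter (hl : PolyTime M l) {p : α → β → Bool}
    (hp : PolyTime M (fun y : α × β => p y.1 y.2)) :
    PolyTime M (fun x => (l x).filter (p x)) := by
  obtain ⟨q, hq⟩ := hl.size_le
  have e : ∀ (x : α) (l : List β) (l' : List β),
      l.foldl (fun s b => if p x b = true then b :: s else s) l' =
        (l.filter (p x)).reverse ++ l' := by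
    intro x l
    induction l with
    | nil => simp
    | cons b l ih =>
      intro l'
      rw [List.foldl_cons, ih, List.filter_cons]
      split_ifs <;> simp
  refine ((PolyTime.const []).foldl hl (g := fun x s b => if p x b = true then b :: s else s)
    ((hp.comp (PolyTime.id.fst.pair PolyTime.id.snd.snd)).ite
      (PolyTime.id.snd.snd.cons PolyTime.id.snd.fst) PolyTime.id.snd.fst)
    ⟨q, fun x l' h => ?_⟩).reverse.of_bits_eq
    (i := fun x => x) (fun _ => rfl) fun x => by rw [e, List.append_nil, List.reverse_reverse]
  rw [e, List.append_nil, size_reverse]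
  exact (size_sublist (List.filter_sublist.trans h.sublist)).trans (hq x)

protected theorem append {l' : α → List β} (hl : PolyTime M l) (hl' : PolyTime M l') :
    PolyTime M (fun x => l x ++ l' x) := by
  obtain ⟨q, hq⟩ := hl.size_le
  obtain ⟨q', hq'⟩ := hl'.size_le
  have e : ∀ (l l' : List β), l.foldl (fun s b => b :: s) l' = l.reverse ++ l' := by
    intro l
    induction l with
    | nil => simp
    | cons b l ih => intro l'; rw [List.foldl_cons, ih]; simp
  refine (hl'.foldl hl.reverse (g := fun _ s b => b :: s)
    (PolyTime.id.snd.snd.cons PolyTime.id.snd.fst) ⟨q + q', fun x l'' h => ?_⟩).of_bits_eq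
    (i := fun x => x) (fun _ => rfl) fun x => by rw [e, List.reverse_reverse]
  rw [e, Polynomial.eval_add]
  have h1 := size_append l''.reverse (l' x)
  have h2 := size_sublist h.sublist
  rw [size_reverse] at h1 h2
  have h3 := hq x
  have h4 := hq' x
  omega

protected theorem flatMap (hl : PolyTime M l) {f : α → β → List γ}
    (hf : PolyTime M (fun y : α × β => f y.1 y.2)) :
    PolyTime M (fun x => (l x).flatMap (f x)) := by
  obtain ⟨q, hq⟩ := hl.size_le
  obtain ⟨r, hr⟩ := hl.size_of_mem hf
  have e : ∀ (x : α) (l : List β) (l' : List γ),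
      l.foldl (fun s b => s ++ f x b) l' = l' ++ l.flatMap (f x) := by
    intro x l
    induction l with
    | nil => simp
    | cons b l ih => intro l'; rw [List.foldl_cons, ih]; simp
  have hsz : ∀ (x : α) (l : List β) (n : ℕ), (∀ b ∈ l, size (f x b) ≤ n) →
      size (l.flatMap (f x)) ≤ l.length * n + 1 := by
    intro x l n
    induction l with
    | nil => intro _; simp [size_nil]
    | cons b l ih =>
      intro h
      rw [List.flatMap_cons, List.length_cons]
      have h1 := size_append (f x b) (l.flatMap (f x))
      have h2 := h b (by simp)
      have h3 := ih fun b hb => h b (by simp [hb])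
      linarith
  refine ((PolyTime.const []).foldl hl (g := fun x s b => s ++ f x b)
    (PolyTime.id.snd.fst.append (hf.comp (PolyTime.id.fst.pair PolyTime.id.snd.snd)))
    ⟨q * r + 1, fun x l' h => ?_⟩).of_bits_eq
    (i := fun x => x) (fun _ => rfl) fun x => by rw [e, List.nil_append]
  rw [e, List.nil_append]
  refine (hsz x l' (r.eval (size x)) fun b hb => hr x b (h.subset hb)).trans ?_
  rw [Polynomial.eval_add, Polynomial.eval_mul, Polynomial.eval_one]
  have h1 := length_le_size (l x)
  have h2 := h.length_le
  have h3 := hq x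
  gcongr
  omega

protected theorem length (hl : PolyTime M l) : PolyTime M (fun x => (l x).length) := by
  obtain ⟨q, hq⟩ := hl.size_le
  have e : ∀ (l : List β) (n : ℕ), l.foldl (fun n _ => n + 1) n = l.length + n := by
    intro l
    induction l with
    | nil => simp
    | cons b l ih => intro n; rw [List.foldl_cons, ih, List.length_cons]; omega
  refine ((PolyTime.const 0).foldl hl (g := fun _ n _ => n + 1)
    PolyTime.id.snd.fst.succ ⟨2 * q, fun x l' h => ?_⟩).of_bits_eq
    (i := fun x => x) (fun _ => rfl) fun x => by rw [e, add_zero]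
  rw [e, add_zero, size_nat, Polynomial.eval_mul, Polynomial.eval_ofNat]
  have h1 := length_le_size (l x)
  have h2 := h.length_le
  have h3 := hq x
  omega

protected theorem tail (hl : PolyTime M l) : PolyTime M (fun x => (l x).tail) :=
  (hl.list_cases (PolyTime.const []) (g := fun _ _ l' => l') PolyTime.id.snd.snd).of_bits_eq
    (i := fun x => x) (fun _ => rfl) fun x => by cases l x <;> rfl

protected theorem headD (hl : PolyTime M l) (d : β) : PolyTime M (fun x => (l x).headD d) :=
  (hl.list_cases (PolyTime.const d) (g := fun _ b _ => b) PolyTime.id.snd.fst).of_bits_eq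
    (i := fun x => x) (fun _ => rfl) fun x => by cases l x <;> rfl

end List

section Nat

variable {f g : α → ℕ}

theorem bits_replicate_unit (n : ℕ) : bits (List.replicate n ()) = bits n := by
  induction n with
  | zero => rfl
  | succ n ih =>
    rw [List.replicate_succ, bits_cons, ih]
    rfl

protected theorem replicate_unit (hf : PolyTime M f) :
    PolyTime M (fun x => List.replicate (f x) ()) :=
  hf.of_bits_eq (i := fun x => x) (fun _ => rfl) fun _ => bits_replicate_unit _

theorem foldl_replicate_unit {σ : Type} (h : σ → σ) (s : σ) (n : ℕ) :
    (List.replicate n ()).foldl (fun s _ => h s) s = h^[n] s := by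
  induction n generalizing s with
  | zero => rfl
  | succ n ih => rw [List.replicate_succ, List.foldl_cons, ih, Function.iterate_succ_apply]

/-- Iteration of a function with polynomially bounded states. -/
protected theorem nat_iterate {s : α → σ} {h : α → σ → σ} (hf : PolyTime M f) (hs : PolyTime M s)
    (hh : PolyTime M (fun y : α × σ => h y.1 y.2))
    (hbd : ∃ q : Polynomial ℕ, ∀ x, ∀ i ≤ f x, size ((h x)^[i] (s x)) ≤ q.eval (size x)) :
    PolyTime M (fun x => (h x)^[f x] (s x)) := by
  obtain ⟨q, hq⟩ := hbd
  refine (hs.foldl hf.replicate_unit (g := fun x s _ => h x s)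
    (hh.comp (PolyTime.id.fst.pair PolyTime.id.snd.fst)) ⟨q, fun x l' hl' => ?_⟩).of_bits_eq
    (i := fun x => x) (fun _ => rfl) fun x => by rw [foldl_replicate_unit]
  obtain ⟨h1, h2⟩ := List.prefix_replicate_iff.1 hl'
  rw [h2, foldl_replicate_unit]
  exact hq x _ h1

protected theorem add (hf : PolyTime M f) (hg : PolyTime M g) : PolyTime M (fun x => f x + g x) := by
  obtain ⟨q, hq⟩ := hf.size_le
  obtain ⟨r, hr⟩ := hg.size_le
  refine (hg.nat_iterate hf (h := fun _ n => n + 1) PolyTime.id.snd.succ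
    ⟨q + r, fun x i hi => ?_⟩).of_bits_eq (i := fun x => x) (fun _ => rfl) fun x => by
      rw [Nat.succ_iterate]
  have h1 := hq x
  have h2 := hr x
  rw [Nat.succ_iterate, Polynomial.eval_add]
  simp only [size_nat] at h1 h2 ⊢
  omega

protected theorem mul (hf : PolyTime M f) (hg : PolyTime M g) : PolyTime M (fun x => f x * g x) := by
  obtain ⟨q, hq⟩ := hf.size_le
  obtain ⟨r, hr⟩ := hg.size_le
  have e : ∀ m n : ℕ, (fun k => k + m)^[n] 0 = m * n := by
    intro m n
    induction n with
    | zero => rfl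
    | succ n ih => rw [Function.iterate_succ_apply', ih, Nat.mul_succ]
  refine (hg.nat_iterate (PolyTime.const 0) (h := fun x n => n + f x)
    (PolyTime.id.snd.add (hf.comp PolyTime.id.fst))
    ⟨2 * (q * r) + 1, fun x i hi => ?_⟩).of_bits_eq (i := fun x => x) (fun _ => rfl) fun x => by
      rw [e]
  have h1 := hq x
  have h2 := hr x
  rw [e, size_nat]
  simp only [Polynomial.eval_add, Polynomial.eval_mul, Polynomial.eval_ofNat, Polynomial.eval_one]
  rw [size_nat] at h1 h2
  gcongr <;> omega

protected theorem pred (hf : PolyTime M f) : PolyTime M (fun x => f x - 1) :=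
  hf.replicate_unit.tail.of_bits_eq (i := fun x => x) (fun _ => rfl) fun x => by
    rw [List.tail_replicate, bits_replicate_unit]

protected theorem sub (hf : PolyTime M f) (hg : PolyTime M g) : PolyTime M (fun x => f x - g x) := by
  obtain ⟨q, hq⟩ := hf.size_le
  refine (hg.nat_iterate hf (h := fun _ n => n - 1) PolyTime.id.snd.pred
    ⟨q, fun x i hi => ?_⟩).of_bits_eq (i := fun x => x) (fun _ => rfl) fun x => by
      rw [show (fun n => n - 1) = Nat.pred from rfl, Nat.pred_iterate]
  have h1 := hq x
  rw [show (fun n => n - 1) = Nat.pred from rfl, Nat.pred_iterate]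
  simp only [size_nat] at h1 ⊢
  omega

protected theorem le (hf : PolyTime M f) (hg : PolyTime M g) :
    PolyTime M (fun x => decide (f x ≤ g x)) := by
  refine ((hf.sub hg).replicate_unit.list_cases (PolyTime.const true) (g := fun _ _ _ => false)
    (PolyTime.const false)).of_bits_eq (i := fun x => x) (fun _ => rfl) fun x => ?_
  congr 1
  cases h : f x - g x with
  | zero => simpa using Nat.sub_eq_zero_iff_le.1 h
  | succ n => simpa [List.replicate_succ] using (by omega : g x < f x)

protected theorem lt (hf : PolyTime M f) (hg : PolyTime M g) :
    PolyTime M (fun x => decide (f x < g x)) :=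
  hf.succ.le hg

protected theorem eq (hf : PolyTime M f) (hg : PolyTime M g) :
    PolyTime M (fun x => decide (f x = g x)) :=
  ((hf.le hg).and (hg.le hf)).of_bits_eq (i := fun x => x) (fun _ => rfl) fun x => by
    congr 1
    rw [← Bool.decide_and]
    exact decide_eq_decide.2 (by omega)

protected theorem range (hf : PolyTime M f) : PolyTime M (fun x => List.range (f x)) := by
  obtain ⟨q, hq⟩ := hf.size_le
  have e : ∀ n : ℕ, (fun l : List ℕ => l.length :: l)^[n] [] = (List.range n).reverse := by
    intro n
    induction n with
    | zero => rfl
    | succ n ih => rw [Function.iterate_succ_apply', ih, List.range_succ]; simp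
  refine (hf.nat_iterate (PolyTime.const []) (h := fun _ l => l.length :: l)
    (PolyTime.id.snd.length.cons PolyTime.id.snd) ⟨q * (q + 1) + 1, fun x i hi => ?_⟩).reverse.of_bits_eq
    (i := fun x => x) (fun _ => rfl) fun x => by rw [e, List.reverse_reverse]
  have h1 := hq x
  rw [size_nat] at h1
  rw [e, size_reverse]
  refine (size_list_le (b := q.eval (size x)) fun j hj => ?_).trans ?_
  · have := List.mem_range.1 hj
    rw [size_nat]
    omega
  · rw [List.length_range, Polynomial.eval_add, Polynomial.eval_mul, Polynomial.eval_add,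
      Polynomial.eval_one]
    gcongr
    omega

protected theorem getD {l : α → List β} (hl : PolyTime M l) (hf : PolyTime M f) (d : β) :
    PolyTime M (fun x => (l x).getD (f x) d) := by
  obtain ⟨q, hq⟩ := hl.size_le
  have e : ∀ (l : List β) (n : ℕ), List.tail^[n] l = l.drop n := by
    intro l n
    induction n with
    | zero => rfl
    | succ n ih => rw [Function.iterate_succ_apply', ih, List.tail_drop]
  refine ((hf.nat_iterate hl (h := fun _ => List.tail) PolyTime.id.snd.tail
    ⟨q, fun x i hi => ?_⟩).headD d).of_bits_eq (i := fun x => x) (fun _ => rfl) fun x => ?_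
  · rw [e]
    exact (size_sublist (List.drop_sublist _ _)).trans (hq x)
  · rw [e, List.getD_eq_getElem?_getD, List.headD_eq_head?_getD, List.head?_drop]

end Nat

end PolyTime

end TopKWinners

/-! ### The dynamic program and its running time. -/

namespace TopKWinners

open Turing

/-! ### The algorithm -/

section Algorithm

/-- Move a leading `true` to the counter. -/
def unaryStep (s : ℕ × List Bool) : ℕ × List Bool :=
  if s.2.headD false = true then (s.1 + 1, s.2.tail) else s

/-- Read a number in unary. -/
def readUnary (l : List Bool) : ℕ × List Bool :=
  ((unaryStep^[l.length] (0, l)).1, (unaryStep^[l.length] (0, l)).2.tail)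

/-- The number of candidates, the number of voters, the distinguished candidate and the entries of
the matrices. -/
abbrev Input : Type := ℕ × ℕ × ℕ × List Bool

/-- Read an instance. -/
def readInstance (l : List Bool) : Input :=
  ((readUnary l).1, (readUnary (readUnary l).2).1, readUnary (readUnary (readUnary l).2).2)

/-- The tie breaker. -/
def tieEntry (I : Input) (a b : ℕ) : Bool := I.2.2.2.getD (a * I.1 + b) false

/-- The partial order of the voter `v`. -/
def prefEntry (I : Input) (v a b : ℕ) : Bool :=
  I.2.2.2.getD ((v + 1) * (I.1 * I.1) + (a * I.1 + b)) false

/-- All tuples of length `K` with entries below `N`. -/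
def tuples (N : ℕ) : ℕ → List (List ℕ)
  | 0 => [[]]
  | K + 1 => (List.range N).flatMap fun x => (tuples N K).map (List.cons x)

/-- The candidate `a` may be at position `p` (counted from `0`) if the candidates `X` are at the
positions `J`. -/
def allowed (K : ℕ) (I : Input) (v : ℕ) (X J : List ℕ) (a p : ℕ) : Bool :=
  (List.range K).all fun i => (!decide (X.getD i 0 = a) || decide (p = J.getD i 0)) &&
    ((!prefEntry I v (X.getD i 0) a || decide (J.getD i 0 < p)) &&
      (!prefEntry I v a (X.getD i 0) || decide (p < J.getD i 0)))

/-- Hall's condition for the positions allowed to the candidates. -/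
def hallTest (K : ℕ) (I : Input) (v : ℕ) (X J : List ℕ) : Bool :=
  (List.range (I.1 + 1)).all fun s => (List.range (I.1 + 1)).all fun e =>
    decide (((List.range I.1).filter fun a => (List.range I.1).all fun p =>
      !allowed K I v X J a p || (decide (s ≤ p) && decide (p < e))).length ≤ e - s)

/-- The totals of the scores of the candidates `X` that are possible after the vote of `v`. -/
def nextTotals (sc : ℕ → ℕ → ℕ) (K : ℕ) (I : Input) (X : List ℕ) (S : List (List ℕ)) (v : ℕ) :
    List (List ℕ) :=
  (tuples (I.2.1 * sc I.1 1 + 1) K).filter fun t => S.any fun s => (tuples I.1 K).any fun J =>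
    hallTest K I v X J && (List.range K).all fun i =>
      decide (t.getD i 0 = s.getD i 0 + sc I.1 (J.getD i 0 + 1))

/-- The possible totals of the scores of the candidates `X`. -/
def totals (sc : ℕ → ℕ → ℕ) (K : ℕ) (I : Input) (X : List ℕ) : List (List ℕ) :=
  (List.range I.2.1).foldl (nextTotals sc K I X) [List.replicate K 0]

/-- The entries of `X` are different. -/
def distinct (K : ℕ) (X : List ℕ) : Bool :=
  (List.range K).all fun i => (List.range i).all fun j => !decide (X.getD i 0 = X.getD j 0)

/-- With total scores `t`, the first of the candidates `X` is beaten by the others. -/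
def beaten (k : ℕ) (I : Input) (X t : List ℕ) : Bool :=
  (List.range k).all fun i => decide (t.getD 0 0 < t.getD (i + 1) 0) ||
    (decide (t.getD 0 0 = t.getD (i + 1) 0) && tieEntry I (X.getD (i + 1) 0) (X.getD 0 0))

/-- Some `k` candidates may beat the distinguished candidate. -/
def refuted (sc : ℕ → ℕ → ℕ) (k : ℕ) (I : Input) : Bool :=
  (tuples I.1 k).any fun D => distinct k D &&
    (totals sc (k + 1) I (I.2.2.1 :: D)).any (beaten k I (I.2.2.1 :: D))

end Algorithm

/-! ### The algorithm runs in polynomial time -/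

namespace PolyTime

variable {M : FinTM2} {α β : Type} [ToTree α] [ToTree β]

theorem left {f : α → β} (h : PolyTime M f) {γ : Type} [ToTree γ] :
    PolyTime M (fun y : α × γ => f y.1) :=
  h.comp PolyTime.id.fst

theorem right {γ : Type} [ToTree γ] : PolyTime M (fun y : α × γ => y.2) :=
  PolyTime.id.snd

theorem unaryStep : PolyTime M unaryStep :=
  (PolyTime.id.snd.headD false).ite (PolyTime.id.fst.succ.pair PolyTime.id.snd.tail) PolyTime.id

/-- Deleting a `true` from the list frees more space than the incremented counter takes. -/
theorem size_iterate_unaryStep (s : ℕ × List Bool) (n : ℕ) :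
    size (TopKWinners.unaryStep^[n] s) ≤ size s := by
  induction n generalizing s with
  | zero => exact le_rfl
  | succ n ih =>
    rw [Function.iterate_succ_apply]
    refine (ih _).trans ?_
    obtain ⟨m, l⟩ := s
    rw [TopKWinners.unaryStep]
    split_ifs with h
    · cases l with
      | nil => cases h
      | cons b l =>
        change b = true at h
        subst h
        simp only [size_pair, size_cons, size_succ, List.tail_cons]
        have : size true = 3 := rfl
        omega
    · exact le_rfl

theorem readUnary {f : α → List Bool} (hf : PolyTime M f) : PolyTime M (fun x => readUnary (f x)) := by
  obtain ⟨q, hq⟩ := hf.size_le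
  have h : PolyTime M (fun x => TopKWinners.unaryStep^[(f x).length] (0, f x)) :=
    hf.length.nat_iterate ((PolyTime.const 0).pair hf) (h := fun _ => TopKWinners.unaryStep)
      (unaryStep.comp right) ⟨q + 2, fun x i _ => (size_iterate_unaryStep _ _).trans (by
        have := hq x
        rw [size_pair, size_zero, Polynomial.eval_add, Polynomial.eval_ofNat]
        dsimp only
        omega)⟩
  exact h.fst.pair h.snd.tail

theorem readInstance : PolyTime M readInstance :=
  have h := PolyTime.id.readUnary
  h.fst.pair (h.snd.readUnary.fst.pair h.snd.readUnary.snd.readUnary)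

section

variable {I : α → Input} {v a b : α → ℕ} {X J : α → List ℕ}

theorem tieEntry (hI : PolyTime M I) (ha : PolyTime M a) (hb : PolyTime M b) :
    PolyTime M (fun x => tieEntry (I x) (a x) (b x)) :=
  hI.snd.snd.snd.getD ((ha.mul hI.fst).add hb) false

theorem prefEntry (hI : PolyTime M I) (hv : PolyTime M v) (ha : PolyTime M a) (hb : PolyTime M b) :
    PolyTime M (fun x => prefEntry (I x) (v x) (a x) (b x)) :=
  hI.snd.snd.snd.getD ((hv.succ.mul (hI.fst.mul hI.fst)).add ((ha.mul hI.fst).add hb)) false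

/-- There are `N ^ K` tuples, which is polynomial because `K` is a constant: each `K` has its own
program, built by induction. This is where it matters that `k` is fixed. -/
theorem tuples {N : α → ℕ} (hN : PolyTime M N) (K : ℕ) : PolyTime M (fun x => tuples (N x) K) := by
  induction K with
  | zero => exact PolyTime.const [[]]
  | succ K ih => exact hN.range.flatMap (ih.left.map (right (α := α).left.cons right))

theorem allowed (K : ℕ) (hI : PolyTime M I) (hv : PolyTime M v) (hX : PolyTime M X)
    (hJ : PolyTime M J) (ha : PolyTime M a) (hb : PolyTime M b) :
    PolyTime M (fun x => allowed K (I x) (v x) (X x) (J x) (a x) (b x)) :=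
  have hx := hX.left.getD (right (γ := ℕ)) 0
  have hj := hJ.left.getD (right (γ := ℕ)) 0
  (PolyTime.const (List.range K)).all (((hx.eq ha.left).not.or (hb.left.eq hj)).and
    (((hI.left.prefEntry hv.left hx ha.left).not.or (hj.lt hb.left)).and
      ((hI.left.prefEntry hv.left ha.left hx).not.or (hb.left.lt hj))))

theorem hallTest (K : ℕ) (hI : PolyTime M I) (hv : PolyTime M v) (hX : PolyTime M X)
    (hJ : PolyTime M J) : PolyTime M (fun x => hallTest K (I x) (v x) (X x) (J x)) :=
  hI.fst.succ.range.all <| hI.fst.succ.range.left.all <|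
    ((hI.fst.range.left.left.filter <| hI.fst.range.left.left.left.all <|
      ((hI.left.left.left.left.allowed K hv.left.left.left.left hX.left.left.left.left
        hJ.left.left.left.left right.left right).not.or
        ((right.left.left.left.le right).and (right.lt right.left.left)))).length).le
      (right.sub right.left)

variable {sc : ℕ → ℕ → ℕ}

theorem nextTotals (hI : PolyTime M I) (hsc : PolyTime M (fun x : ℕ × ℕ => sc x.1 x.2)) (K : ℕ)
    (hv : PolyTime M v) (hX : PolyTime M X) {S : α → List (List ℕ)} (hS : PolyTime M S) :
    PolyTime M (fun x => nextTotals sc K (I x) (X x) (S x) (v x)) :=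
  (((hI.snd.fst.mul (hsc.comp (hI.fst.pair (PolyTime.const 1)))).succ).tuples K).filter <|
    hS.left.any <| (hI.fst.tuples K).left.left.any <|
      (hI.left.left.left.hallTest K hv.left.left.left hX.left.left.left right).and <|
        (PolyTime.const (List.range K)).all <|
          (right.left.left.left.getD right 0).eq <| (right.left.left.getD right 0).add <|
            hsc.comp (hI.fst.left.left.left.left.pair (right.left.getD right 0).succ)

theorem totals (hI : PolyTime M I) (hsc : PolyTime M (fun x : ℕ × ℕ => sc x.1 x.2)) (K : ℕ)
    (hX : PolyTime M X) : PolyTime M (fun x => totals sc K (I x) (X x)) := by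
  obtain ⟨q, hq⟩ := (((hI.snd.fst.mul
    (hsc.comp (hI.fst.pair (PolyTime.const 1)))).succ).tuples K).size_le
  refine (PolyTime.const [List.replicate K 0]).foldl hI.snd.fst.range
    (g := fun x => TopKWinners.nextTotals sc K (I x) (X x))
    (hI.left.nextTotals hsc K right.snd hX.left right.fst)
    ⟨Polynomial.C (size [List.replicate K 0]) + q, fun x l _ => ?_⟩
  rw [Polynomial.eval_add, Polynomial.eval_C]
  -- After the first vote every state is a sublist of the same list of tuples, so the states do not
  -- grow from round to round.
  rcases l.eq_nil_or_concat with rfl | ⟨l, b, rfl⟩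
  · exact Nat.le_add_right _ _
  · rw [List.concat_eq_append, List.foldl_append]
    exact ((size_sublist List.filter_sublist).trans (hq x)).trans (Nat.le_add_left _ _)

theorem distinct (K : ℕ) (hX : PolyTime M X) : PolyTime M (fun x => distinct K (X x)) :=
  (PolyTime.const (List.range K)).all <| right.range.all <|
    ((hX.left.left.getD right.left 0).eq (hX.left.left.getD right 0)).not

theorem beaten (k : ℕ) (hI : PolyTime M I) (hX : PolyTime M X) (hJ : PolyTime M J) :
    PolyTime M (fun x => beaten k (I x) (X x) (J x)) :=
  have h0 := hJ.left.getD (PolyTime.const (α := α × ℕ) 0) 0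
  have h1 := hJ.left.getD (right (γ := ℕ)).succ 0
  (PolyTime.const (List.range k)).all <| (h0.lt h1).or <| (h0.eq h1).and <|
    hI.left.tieEntry (hX.left.getD right.succ 0) (hX.left.getD (PolyTime.const 0) 0)

theorem refuted (hI : PolyTime M I) (hsc : PolyTime M (fun x : ℕ × ℕ => sc x.1 x.2)) (k : ℕ) :
    PolyTime M (fun x => refuted sc k (I x)) :=
  have hX := hI.snd.snd.fst.left.cons (right (γ := List ℕ))
  (hI.fst.tuples k).any <| (right.distinct k).and <|
    (hI.left.totals hsc (k + 1) hX).any <| hI.left.left.beaten k hX.left right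

end

end PolyTime

/-! ### The scores are computed by a program -/

section Score

/-- The value of a binary number, with the least significant digit first. -/
def binaryValue (l : List Bool) : ℕ := l.foldr (fun b n => n + n + if b = true then 1 else 0) 0

theorem binaryValue_encodePosNum (p : PosNum) :
    binaryValue (Computability.encodePosNum p) = p := by
  induction p with
  | one => rfl
  | bit0 p ih => exact congrArg (fun n => n + n) ih
  | bit1 p ih => exact congrArg (fun n => n + n + 1) ih

theorem binaryValue_encodeNat (n : ℕ) : binaryValue (Computability.encodeNat n) = n := by
  conv_rhs => rw [← Num.to_of_nat n]
  rw [Computability.encodeNat]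
  cases (n : Num) with
  | zero => rfl
  | pos p => exact binaryValue_encodePosNum p

theorem length_encodePosNum_le (p : PosNum) : (Computability.encodePosNum p).length ≤ p := by
  induction p with
  | one => exact le_rfl
  | bit0 p ih =>
    have : 0 < (p : ℕ) := PosNum.cast_pos p
    change (Computability.encodePosNum p).length + 1 ≤ (p : ℕ) + p
    omega
  | bit1 p ih =>
    change (Computability.encodePosNum p).length + 1 ≤ (p : ℕ) + p + 1
    omega

theorem length_encodeNat_le (n : ℕ) : (Computability.encodeNat n).length ≤ n := by
  conv_rhs => rw [← Num.to_of_nat n]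
  rw [Computability.encodeNat]
  cases (n : Num) with
  | zero => exact le_rfl
  | pos p => exact length_encodePosNum_le p

/-- Horner's scheme never decreases, so all intermediate values are bounded by the final score. -/
theorem foldl_binary_mono (l : List Bool) (n : ℕ) :
    n ≤ l.foldl (fun n b => n + n + if b = true then 1 else 0) n := by
  induction l generalizing n with
  | nil => exact le_rfl
  | cons b l ih => exact le_trans (by dsimp only; omega) (ih _)

/-- The scores, extended by `0` to all pairs. -/
def PositionalScoringRule.scoreOrZero (r : PositionalScoringRule) (m j : ℕ) : ℕ :=
  if (decide (1 ≤ j) && decide (j ≤ m)) = true then r.score m j else 0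

theorem PolyTime.unary {M : FinTM2} {α : Type} [ToTree α] {f : α → ℕ} (hf : PolyTime M f) :
    PolyTime M (fun x => unary (f x)) :=
  ((hf.replicate_unit.map (f := fun _ _ => true) (PolyTime.const true)).append (PolyTime.const [false])).of_bits_eq
    (i := fun x => x) (fun _ => rfl) fun x => by rw [List.map_replicate]; rfl

/-- The score machine answers in binary, least significant digit first; the reversal caused by the
oracle call puts the digits in the order of Horner's scheme, which converts to unary. The polynomial
bound on the scores keeps the unary value small. -/
theorem PolyTime.scoreOrZero (r : PositionalScoringRule) (hpoly : r.HasPolynomialScores)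
    (H : TM2ComputableInPolyTime encodeScoreIndex Computability.encodeNat
      (fun x : ScoreIndex => r.score x.1.1 x.1.2)) :
    PolyTime H.tm (fun x : ℕ × ℕ => r.scoreOrZero x.1 x.2) := by
  obtain ⟨p, hp⟩ := hpoly
  have hb : ∀ x : ScoreIndex, r.score x.1.1 x.1.2 ≤ p.eval (size x) := fun x =>
    (hp _ _ x.2.1 x.2.2).trans (eval_mono p (by
      change _ ≤ size x.1
      rw [size_pair, size_nat]; omega))
  have h1 : PolyTime H.tm (fun x : ScoreIndex => (encodeScoreIndex x).reverse) :=
    (PolyTime.subtype_val.fst.unary.append PolyTime.subtype_val.snd.unary).reverse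
  have h2 := h1.oracle H ⟨p, fun x => (length_encodeNat_le _).trans (hb x)⟩
  have h3 : PolyTime H.tm (fun x : ScoreIndex => r.score x.1.1 x.1.2) := by
    refine ((PolyTime.const 0).foldl h2 (g := fun _ n b => n + n + if b = true then 1 else 0)
      ((PolyTime.id.snd.fst.add PolyTime.id.snd.fst).add
        (PolyTime.id.snd.snd.ite (PolyTime.const 1) (PolyTime.const 0)))
      ⟨2 * p + 1, fun x l' hl' => ?_⟩).of_bits_eq
      (i := fun x => x) (fun _ => rfl) fun x => by
        rw [List.foldl_reverse]
        exact congrArg bits (binaryValue_encodeNat _).symm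
    obtain ⟨l'', hl''⟩ := hl'
    have h4 := foldl_binary_mono l'' (l'.foldl (fun n b => n + n + if b = true then 1 else 0) 0)
    rw [← List.foldl_append, hl'', List.foldl_reverse] at h4
    have h5 := h4.trans ((binaryValue_encodeNat _).le.trans (hb x))
    rw [size_nat, Polynomial.eval_add, Polynomial.eval_mul, Polynomial.eval_ofNat,
      Polynomial.eval_one]
    omega
  have h6 : PolyTime H.tm (fun x : ℕ × ℕ => decide (1 ≤ x.2) && decide (x.2 ≤ x.1)) :=
    ((PolyTime.const 1).le PolyTime.id.snd).and (PolyTime.id.snd.le PolyTime.id.fst)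
  exact h6.dite (f := fun x => r.score x.1.1 x.1.2) (h3.of_bits_eq
    (i := fun x => ⟨x.1, by simpa using x.2⟩) (fun _ => rfl) fun _ => rfl) (PolyTime.const 0)

end Score

end TopKWinners

/-! ### Hall's condition for intervals and linear extensions with prescribed positions. -/

namespace TopKWinners

/-! ### Linear extensions with prescribed positions -/

section Matching

variable {C : Type} [Fintype C]

/-- Hall's condition for sets of integers without gaps follows from its instances for intervals. -/
theorem card_le_card_biUnion_of_convex {W : C → Finset ℕ} {m : ℕ}
    (hm : ∀ a, ∀ p ∈ W a, p < m)
    (hW : ∀ a, ∀ p ∈ W a, ∀ q ∈ W a, ∀ t, p ≤ t → t ≤ q → t ∈ W a)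
    (h : ∀ s ≤ m, ∀ e ≤ m,
      (Finset.univ.filter fun a => ∀ p ∈ W a, s ≤ p ∧ p < e).card ≤ e - s) (A : Finset C) :
    A.card ≤ (A.biUnion W).card := by
  induction A using Finset.strongInduction with
  | H A ih =>
    rcases (A.biUnion W).eq_empty_or_nonempty with hU | hU
    -- All sets indexed by `A` are empty, so every element of `A` is counted in the instance for the
    -- empty interval.
    · have h0 := h 0 (Nat.zero_le _) 0 (Nat.zero_le _)
      rw [hU, Finset.card_empty]
      refine (Finset.card_le_card fun a ha => ?_).trans h0
      refine Finset.mem_filter.2 ⟨Finset.mem_univ _, fun p hp => ?_⟩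
      have : p ∈ A.biUnion W := Finset.mem_biUnion.2 ⟨a, ha, hp⟩
      rw [hU] at this
      exact absurd this (Finset.notMem_empty _)
    · obtain ⟨s, hs, hsmin⟩ : ∃ s ∈ A.biUnion W, ∀ p ∈ A.biUnion W, s ≤ p :=
        ⟨_, Finset.min'_mem _ hU, fun p hp => Finset.min'_le _ p hp⟩
      obtain ⟨e, he, hemax⟩ : ∃ e ∈ A.biUnion W, ∀ p ∈ A.biUnion W, p ≤ e :=
        ⟨_, Finset.max'_mem _ hU, fun p hp => Finset.le_max' _ p hp⟩
      obtain ⟨a, haA, ha⟩ := Finset.mem_biUnion.1 hs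
      obtain ⟨b, hbA, hb⟩ := Finset.mem_biUnion.1 he
      -- If the union fills the interval from `s` to `e`, the hypothesis for that interval suffices.
      -- Otherwise it misses some `t`; having no gaps, each set lies on one side of `t`, and
      -- induction applies to the two sides, whose unions are disjoint. Both sides are proper,
      -- because `s` and `e` are attained.
      by_cases hfull : Finset.Ico s (e + 1) ⊆ A.biUnion W
      · refine le_trans ?_ ((Nat.card_Ico s (e + 1)).symm.le.trans (Finset.card_le_card hfull))
        refine (Finset.card_le_card fun c hc => ?_).trans
          (h s (hm a s ha).le (e + 1) (hm b e hb))
        refine Finset.mem_filter.2 ⟨Finset.mem_univ _, fun p hp => ?_⟩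
        have hpU : p ∈ A.biUnion W := Finset.mem_biUnion.2 ⟨c, hc, hp⟩
        exact ⟨hsmin p hpU, Nat.lt_succ_of_le (hemax p hpU)⟩
      · obtain ⟨t, ht, htU⟩ := Finset.not_subset.1 hfull
        obtain ⟨hst, hte⟩ := Finset.mem_Ico.1 ht
        have htW : ∀ c ∈ A, t ∉ W c := fun c hc h => htU (Finset.mem_biUnion.2 ⟨c, hc, h⟩)
        have hlow : ∀ c ∈ A.filter (fun c => ∀ p ∈ W c, p < t), ∀ p ∈ W c, p < t :=
          fun c hc => (Finset.mem_filter.1 hc).2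
        have hhigh : ∀ c ∈ A.filter (fun c => ¬ ∀ p ∈ W c, p < t), ∀ p ∈ W c, t < p := by
          intro c hc p hp
          obtain ⟨hcA, hq⟩ := Finset.mem_filter.1 hc
          push Not at hq
          obtain ⟨q, hq, htq⟩ := hq
          by_contra hpt
          exact htW c hcA (hW c p hp q hq t (not_lt.1 hpt) htq)
        have hlt : s < t := lt_of_le_of_ne hst fun h => htU (h ▸ hs)
        have h1 := ih (A.filter fun c => ∀ p ∈ W c, p < t) (Finset.filter_ssubset.2
          ⟨b, hbA, fun h => absurd (h e hb) (by omega)⟩)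
        have h2 := ih (A.filter fun c => ¬ ∀ p ∈ W c, p < t) (Finset.filter_ssubset.2
          ⟨a, haA, fun h => by
            have := hhigh a (Finset.mem_filter.2 ⟨haA, h⟩) s ha
            omega⟩)
        have hdisj : Disjoint ((A.filter fun c => ∀ p ∈ W c, p < t).biUnion W)
            ((A.filter fun c => ¬ ∀ p ∈ W c, p < t).biUnion W) := by
          rw [Finset.disjoint_left]
          intro p hp hp'
          obtain ⟨c, hc, hpc⟩ := Finset.mem_biUnion.1 hp
          obtain ⟨d, hd, hpd⟩ := Finset.mem_biUnion.1 hp'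
          exact absurd (hlow c hc p hpc) (hhigh d hd p hpd).le.not_gt
        rw [← Finset.card_filter_add_card_filter_not (s := A) fun c => ∀ p ∈ W c, p < t]
        refine (add_le_add h1 h2).trans ?_
        rw [← Finset.card_union_of_disjoint hdisj]
        exact Finset.card_le_card (Finset.union_subset
          (Finset.biUnion_subset_biUnion_of_subset_left _ (Finset.filter_subset _ _))
          (Finset.biUnion_subset_biUnion_of_subset_left _ (Finset.filter_subset _ _)))

/-- If elements can be exchanged whenever they are in the wrong order, some injective choice is
monotone. -/
theorem exists_injective_monotone {P : C → C → Prop} (hP : IsStrictOrder C P)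
    {W : C → Finset ℕ} (hswap : ∀ a b, P a b → ∀ p ∈ W a, ∀ q ∈ W b, q < p → q ∈ W a ∧ p ∈ W b)
    {f : C → ℕ} (hf : Function.Injective f) (hfW : ∀ a, f a ∈ W a) :
    ∃ g : C → ℕ, Function.Injective g ∧ (∀ a, g a ∈ W a) ∧ ∀ a b, P a b → g a < g b := by
  classical
  -- The weight counts the elements that come after `a` in `P`, so it strictly decreases along `P`.
  obtain ⟨w, hw⟩ : ∃ w : C → ℕ, ∀ a b, P a b → w b < w a := by
    refine ⟨fun a => (Finset.univ.filter fun d => P a d).card, fun a b hab => ?_⟩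
    refine Finset.card_lt_card (Finset.ssubset_iff_of_subset (fun d hd => ?_) |>.2 ⟨b, ?_, ?_⟩)
    · simp only [Finset.mem_filter_univ] at hd ⊢
      exact _root_.trans hab hd
    · simpa using hab
    · simpa using irrefl b
  let good : Set (C → ℕ) := {g | Function.Injective g ∧ ∀ a, g a ∈ W a}
  -- Among all admissible injective choices take one minimizing the weighted sum. By the
  -- rearrangement inequality, exchanging the values of a pair in the wrong order would make the sum
  -- strictly smaller.
  obtain ⟨g, hg, hmin⟩ : ∃ g ∈ good, ∀ g' ∈ good, ∑ c, g c * w c ≤ ∑ c, g' c * w c := by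
    have hne : good.Nonempty := ⟨f, hf, hfW⟩
    exact ⟨Function.argminOn (fun g : C → ℕ => ∑ c, g c * w c) good hne,
      Function.argminOn_mem _ _ hne, fun g' hg' => Function.argminOn_le (fun g : C → ℕ => ∑ c, g c * w c) _ hg'⟩
  refine ⟨g, hg.1, hg.2, fun a b hab => ?_⟩
  by_contra hlt
  have hne : a ≠ b := fun h => irrefl b (h ▸ hab)
  have hba : g b < g a := lt_of_le_of_ne (not_lt.1 hlt) fun h => hne (hg.1 h.symm)
  obtain ⟨h1, h2⟩ := hswap a b hab _ (hg.2 a) _ (hg.2 b) hba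
  have hg' : (fun c => g (Equiv.swap a b c)) ∈ good := by
    refine ⟨hg.1.comp (Equiv.swap a b).injective, fun c => ?_⟩
    rcases eq_or_ne c a with rfl | hca
    · simpa using h1
    · rcases eq_or_ne c b with rfl | hcb
      · simpa using h2
      · simpa [Equiv.swap_apply_of_ne_of_ne hca hcb] using hg.2 c
  have hsum : ∀ F : C → ℕ, ∑ c, F c = F a + (F b + ∑ c ∈ (Finset.univ.erase a).erase b, F c) := by
    intro F
    rw [Finset.add_sum_erase _ F (Finset.mem_erase.2 ⟨hne.symm, Finset.mem_univ _⟩),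
      Finset.add_sum_erase _ F (Finset.mem_univ _)]
  have hle := hmin _ hg'
  rw [hsum, hsum fun c => g (Equiv.swap a b c) * w c] at hle
  have hrest : ∑ c ∈ (Finset.univ.erase a).erase b, g (Equiv.swap a b c) * w c =
      ∑ c ∈ (Finset.univ.erase a).erase b, g c * w c := by
    refine Finset.sum_congr rfl fun c hc => ?_
    rw [Finset.mem_erase, Finset.mem_erase] at hc
    rw [Equiv.swap_apply_of_ne_of_ne hc.2.1 hc.1]
  rw [hrest, Equiv.swap_apply_left, Equiv.swap_apply_right] at hle
  have hwab := hw a b hab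
  nlinarith

end Matching

section Positions

variable {C : Type}

theorem one_le_position (T : C → C → Prop) (a : C) : 1 ≤ position T a :=
  Nat.le_add_left _ _

variable [Fintype C]

theorem position_lt_of_rel {T : C → C → Prop} (hT : IsStrictTotalOrder C T) {a b : C}
    (h : T a b) : position T a < position T b := by
  refine Nat.succ_lt_succ (Set.ncard_lt_ncard ⟨fun d hd => _root_.trans hd h, fun hs => ?_⟩
    (Set.toFinite _))
  exact irrefl a (hs h)

theorem position_injective {T : C → C → Prop} (hT : IsStrictTotalOrder C T) :
    Function.Injective (position T) := by
  intro a b hab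
  rcases trichotomous_of T a b with h | h | h
  · exact absurd hab (position_lt_of_rel hT h).ne
  · exact h
  · exact absurd hab (position_lt_of_rel hT h).ne'

theorem position_le_card {T : C → C → Prop} (hT : IsStrictTotalOrder C T) (a : C) :
    position T a ≤ Fintype.card C := by
  rw [← Nat.card_eq_fintype_card, ← Set.ncard_univ]
  exact Set.ncard_lt_ncard ⟨Set.subset_univ _, fun h => irrefl a (h (Set.mem_univ a))⟩
    (Set.toFinite _)

/-- An injection into the first `Fintype.card C` numbers is onto, so exactly `f a` elements have a
value below `f a`. -/
theorem position_of_bijective {f : C → ℕ} (hf : Function.Injective f)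
    (hlt : ∀ a, f a < Fintype.card C) (a : C) : position (fun a b => f a < f b) a = f a + 1 := by
  classical
  have himg : Finset.univ.image f = Finset.range (Fintype.card C) := by
    refine Finset.eq_of_subset_of_card_le (fun p hp => ?_) ?_
    · obtain ⟨b, -, rfl⟩ := Finset.mem_image.1 hp
      exact Finset.mem_range.2 (hlt b)
    · rw [Finset.card_range, Finset.card_image_of_injective _ hf, Finset.card_univ]
  rw [position, Set.ncard_eq_toFinset_card', ← Finset.card_image_of_injective _ hf]
  congr 1
  refine (congrArg Finset.card ?_).trans (Finset.card_range (f a))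
  ext p
  simp only [Set.toFinset_ofPred, Finset.mem_image, Finset.mem_filter_univ,
    Finset.mem_range]
  constructor
  · rintro ⟨b, hb, rfl⟩
    exact hb
  · intro hp
    have : p ∈ Finset.univ.image f := by
      rw [himg]
      exact Finset.mem_range.2 (hp.trans (hlt a))
    obtain ⟨b, -, rfl⟩ := Finset.mem_image.1 this
    exact ⟨b, hp, rfl⟩

/-- The position `p` (counted from `0`) is compatible with the order `P` and the positions `j` of
the elements `x`. -/
def Fits {ι : Type} (P : C → C → Prop) (x : ι → C) (j : ι → ℕ) (a : C) (p : ℕ) : Prop :=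
  ∀ i, (x i = a → p = j i) ∧ (P (x i) a → j i < p) ∧ (P a (x i) → p < j i)

open Classical in
/-- A partial order has a linear extension with prescribed positions of some elements if and only
if Hall's condition holds for the intervals of positions. -/
theorem exists_linear_extension_iff {ι : Type} {P : C → C → Prop} (hP : IsStrictOrder C P)
    (x : ι → C) {j : ι → ℕ} :
    (∃ T : C → C → Prop, IsStrictTotalOrder C T ∧ (∀ a b, P a b → T a b) ∧
      ∀ i, position T (x i) = j i + 1) ↔
    ∀ s ≤ Fintype.card C, ∀ e ≤ Fintype.card C,
      (Finset.univ.filter fun a => ∀ p < Fintype.card C, Fits P x j a p → s ≤ p ∧ p < e).card ≤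
        e - s := by
  constructor
  · rintro ⟨T, hT, hPT, hj⟩ s - e -
    -- In a linear extension the position of each candidate, counted from `0`, fits. The counted
    -- candidates are therefore placed injectively in the interval from `s` to `e`.
    rw [← Nat.card_Ico]
    refine Finset.card_le_card_of_injOn (fun a => position T a - 1) (fun a ha => ?_) ?_
    · have h1 := one_le_position T a
      have h2 := position_le_card hT a
      refine Finset.mem_coe.2 (Finset.mem_Ico.2 ((Finset.mem_filter.1 (Finset.mem_coe.1 ha)).2 _
        (by dsimp only; omega) fun i => ⟨?_, fun h => ?_, fun h => ?_⟩)) <;> dsimp only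
      · rintro rfl
        rw [hj, Nat.add_sub_cancel]
      · have := position_lt_of_rel hT (hPT _ _ h)
        rw [hj] at this
        omega
      · have := position_lt_of_rel hT (hPT _ _ h)
        rw [hj] at this
        omega
    · intro a _ b _ hab
      have h1 := one_le_position T a
      have h2 := one_le_position T b
      refine position_injective hT ?_
      dsimp only at hab
      omega
  · intro h
    let W : C → Finset ℕ := fun a => (Finset.range (Fintype.card C)).filter (Fits P x j a)
    have hW : ∀ a p, p ∈ W a ↔ p < Fintype.card C ∧ Fits P x j a p := fun a p => by
      simp [W]
    -- `Fits` is a conjunction of prescribed values and one-sided bounds, so it has no gaps.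
    have hall := card_le_card_biUnion_of_convex (W := W) (m := Fintype.card C)
      (fun a p hp => ((hW a p).1 hp).1)
      (fun a p hp q hq t hpt htq => by
        obtain ⟨-, hp⟩ := (hW a p).1 hp
        obtain ⟨hqm, hq⟩ := (hW a q).1 hq
        refine (hW a t).2 ⟨by omega, fun i => ⟨fun hi => ?_, fun hi => ?_, fun hi => ?_⟩⟩
        · have h1 := (hp i).1 hi
          have h2 := (hq i).1 hi
          omega
        · have := (hp i).2.1 hi
          omega
        · have := (hq i).2.2 hi
          omega)
      (fun s hs e he => by
        refine (Finset.card_le_card fun a ha => ?_).trans (h s hs e he)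
        simp only [Finset.mem_filter_univ, hW] at ha ⊢
        exact fun p hp hfit => ha p ⟨hp, hfit⟩)
    obtain ⟨f, hf, hfW⟩ := (Finset.all_card_le_biUnion_card_iff_exists_injective W).1 hall
    -- If `P a b`, transitivity passes lower bounds from `a` to `b` and upper bounds from `b` to
    -- `a`, so positions in the wrong order may be exchanged. If `a` or `b` has a prescribed
    -- position, the bound it puts on the other excludes the wrong order.
    obtain ⟨g, hg, hgW, hmono⟩ := exists_injective_monotone hP (W := W)
      (fun a b hab p hp q hq hqp => by
        obtain ⟨hpm, hp⟩ := (hW a p).1 hp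
        obtain ⟨hqm, hq⟩ := (hW b q).1 hq
        constructor
        · refine (hW a q).2 ⟨hqm, fun i => ⟨?_, fun hi => ?_, fun hi => ?_⟩⟩
          · rintro rfl
            have h1 := (hp i).1 rfl
            have h2 := (hq i).2.1 hab
            omega
          · exact (hq i).2.1 (_root_.trans hi hab)
          · exact hqp.trans ((hp i).2.2 hi)
        · refine (hW b p).2 ⟨hpm, fun i => ⟨?_, fun hi => ?_, fun hi => ?_⟩⟩
          · rintro rfl
            have h1 := (hq i).1 rfl
            have h2 := (hp i).2.2 hab
            omega
          · exact ((hq i).2.1 hi).trans hqp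
          · exact (hp i).2.2 (_root_.trans hab hi)) hf hfW
    refine ⟨fun a b => g a < g b, ?_, hmono, fun i => ?_⟩
    · exact { trichotomous := fun a b h1 h2 => hg (le_antisymm (not_lt.1 h2) (not_lt.1 h1))
              irrefl := fun a => lt_irrefl _
              trans := fun a b c h1 h2 => lt_trans h1 h2 }
    · rw [position_of_bijective hg fun a => ((hW a _).1 (hgW a)).1]
      exact congrArg (· + 1) ((((hW _ _).1 (hgW (x i))).2 i).1 rfl)

end Positions

end TopKWinners

/-! ### Decoding of instances and correctness of the dynamic program. -/

namespace TopKWinners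

/-! ### Reading the input -/

/-- A list starting with `false` is a fixed point, so surplus iterations are harmless; the reader
performs one for each symbol of the whole input. -/
theorem iterate_unaryStep (l : List Bool) (n a i : ℕ) (h : n ≤ i) :
    unaryStep^[i] (a, List.replicate n true ++ false :: l) = (a + n, false :: l) := by
  induction n generalizing a i with
  | zero => exact Function.iterate_fixed rfl i
  | succ n ih =>
    obtain ⟨i, rfl⟩ : ∃ i', i = i' + 1 := ⟨i - 1, by omega⟩
    rw [Function.iterate_succ_apply, show a + (n + 1) = a + 1 + n by omega]
    exact ih (a + 1) i (by omega)

theorem readUnary_unary (n : ℕ) (l : List Bool) : readUnary (unary n ++ l) = (n, l) := by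
  have e : unary n ++ l = List.replicate n true ++ false :: l := by simp [unary]
  have h := iterate_unaryStep l n 0 (unary n ++ l).length (by simp [unary])
  rw [← e, zero_add] at h
  rw [readUnary, h]
  rfl

/-- The entries of the matrices of an instance. -/
noncomputable def matrixBits (I : Instance) : List Bool :=
  encodeRel I.tie ++ (List.finRange I.n).flatMap fun v => encodeRel (I.profile v)

theorem readInstance_encodeInstance (I : Instance) :
    readInstance (encodeInstance I) = (I.m, I.n, (I.c : ℕ), matrixBits I) := by
  have e : encodeInstance I = unary I.m ++ (unary I.n ++ (unary I.c ++ matrixBits I)) := by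
    simp only [encodeInstance, matrixBits, List.append_assoc]
  rw [e, readInstance, readUnary_unary, readUnary_unary, readUnary_unary]

theorem getD_flatMap {α β : Type} {f : α → List β} {L : ℕ} (d : β) (l : List α)
    (hf : ∀ a, (f a).length = L) (i : ℕ) (hi : i < l.length) {j : ℕ} (hj : j < L) :
    (l.flatMap f).getD (i * L + j) d = (f l[i]).getD j d := by
  induction l generalizing i with
  | nil => cases hi
  | cons a l ih =>
    rw [List.flatMap_cons]
    cases i with
    | zero =>
      rw [Nat.zero_mul, Nat.zero_add, List.getD_append _ _ _ _ (by rw [hf]; exact hj)]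
      rfl
    | succ i =>
      rw [List.getD_append_right _ _ _ _ (by rw [hf, Nat.succ_mul]; omega), hf,
        show (i + 1) * L + j - L = i * L + j by rw [Nat.succ_mul]; omega,
        ih i (Nat.lt_of_succ_lt_succ hi)]
      rfl

theorem length_encodeRel {m : ℕ} (R : Fin m → Fin m → Prop) : (encodeRel R).length = m * m := by
  simp [encodeRel, List.length_flatMap]

theorem getD_encodeRel {m : ℕ} (R : Fin m → Fin m → Prop) (a b : Fin m) :
    (encodeRel R).getD (a * m + b) false = true ↔ R a b := by
  rw [encodeRel, getD_flatMap false _ (fun a => by simp) a (by simp) b.2]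
  simp

theorem index_lt {m : ℕ} (a b : Fin m) : (a : ℕ) * m + b < m * m := by
  have ha := a.2
  have hb := b.2
  nlinarith

theorem tieEntry_iff (I : Instance) (a b : Fin I.m) :
    tieEntry (I.m, I.n, (I.c : ℕ), matrixBits I) a b = true ↔ I.tie a b := by
  change (matrixBits I).getD (a * I.m + b) false = true ↔ _
  rw [matrixBits, List.getD_append _ _ _ _ (by rw [length_encodeRel]; exact index_lt a b),
    getD_encodeRel]

/-- The tie breaker occupies the first block of `m * m` bits, hence the shift of the voter index by
one. -/
theorem prefEntry_iff (I : Instance) (v : Fin I.n) (a b : Fin I.m) :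
    prefEntry (I.m, I.n, (I.c : ℕ), matrixBits I) v a b = true ↔ I.profile v a b := by
  change (matrixBits I).getD ((v + 1) * (I.m * I.m) + (a * I.m + b)) false = true ↔ _
  rw [matrixBits, List.getD_append_right _ _ _ _
    (by rw [length_encodeRel, Nat.succ_mul]; omega), length_encodeRel,
    show ((v : ℕ) + 1) * (I.m * I.m) + (a * I.m + b) - I.m * I.m =
      v * (I.m * I.m) + (a * I.m + b) by rw [Nat.succ_mul]; omega,
    getD_flatMap false _ (fun v => length_encodeRel _) v (by simp) (index_lt a b),
    getD_encodeRel]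
  simp

/-! ### Correctness of the algorithm -/

theorem mem_tuples {N K : ℕ} {t : List ℕ} :
    t ∈ tuples N K ↔ t.length = K ∧ ∀ i < K, t.getD i 0 < N := by
  induction K generalizing t with
  | zero => simp [tuples]
  | succ K ih =>
    simp only [tuples, List.mem_flatMap, List.mem_range, List.mem_map, ih]
    constructor
    · rintro ⟨x, hx, t, ⟨ht, h⟩, rfl⟩
      refine ⟨by rw [List.length_cons, ht], fun i hi => ?_⟩
      cases i with
      | zero => exact hx
      | succ i => exact h i (by omega)
    · rintro ⟨ht, h⟩
      cases t with
      | nil => cases ht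
      | cons x t =>
        exact ⟨x, h 0 (by omega), t, ⟨Nat.succ_injective ht, fun i hi => h (i + 1) (by omega)⟩, rfl⟩

theorem length_filter_range (m : ℕ) (q : ℕ → Bool) :
    ((List.range m).filter q).length = (Finset.univ.filter fun a : Fin m => q a = true).card := by
  rw [Finset.card_filter, Fin.sum_univ_eq_sum_range (fun i => if q i = true then 1 else 0)]
  induction m with
  | zero => rfl
  | succ m ih =>
    rw [List.range_succ, List.filter_append, List.length_append, ih, Finset.sum_range_succ]
    cases h : q m <;> simp [h]

theorem getD_ofFn {K : ℕ} (f : Fin K → ℕ) (i : Fin K) : (List.ofFn f).getD i 0 = f i := by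
  simp [List.getD_eq_getElem?_getD]

section Correctness

variable {m n c : ℕ} {w : List Bool} {K : ℕ} {X : List ℕ} {x : Fin K → Fin m}

theorem allowed_iff {P : Fin m → Fin m → Prop} {v : ℕ}
    (hP : ∀ a b : Fin m, prefEntry (m, n, c, w) v a b = true ↔ P a b)
    (hx : ∀ i : Fin K, X.getD i 0 = x i) (J : List ℕ) (a : Fin m) (p : ℕ) :
    allowed K (m, n, c, w) v X J a p = true ↔ Fits P x (fun i => J.getD i 0) a p := by
  have key : ∀ i : Fin K, ((!decide (X.getD i 0 = a) || decide (p = J.getD i 0)) &&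
      ((!prefEntry (m, n, c, w) v (X.getD i 0) a || decide (J.getD i 0 < p)) &&
      (!prefEntry (m, n, c, w) v a (X.getD i 0) || decide (p < J.getD i 0)))) = true ↔
      (x i = a → p = J.getD i 0) ∧ (P (x i) a → J.getD i 0 < p) ∧
        (P a (x i) → p < J.getD i 0) := by
    intro i
    rw [hx, Bool.and_eq_true, Bool.and_eq_true, ← hP, ← hP, Bool.or_eq_true, Bool.or_eq_true,
      Bool.or_eq_true, Bool.not_eq_true', Bool.not_eq_true', Bool.not_eq_true',
      decide_eq_false_iff_not, decide_eq_true_iff, decide_eq_true_iff, decide_eq_true_iff,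
      ← Bool.not_eq_true, ← Bool.not_eq_true, ← imp_iff_not_or, ← imp_iff_not_or,
      ← imp_iff_not_or, Fin.ext_iff]
  rw [allowed, List.all_eq_true]
  exact ⟨fun h i => (key i).1 (h i (List.mem_range.2 i.2)),
    fun h i hi => (key ⟨i, List.mem_range.1 hi⟩).2 (h _)⟩

theorem hallTest_iff {P : Fin m → Fin m → Prop} (hS : IsStrictOrder (Fin m) P) {v : ℕ}
    (hP : ∀ a b : Fin m, prefEntry (m, n, c, w) v a b = true ↔ P a b)
    (hx : ∀ i : Fin K, X.getD i 0 = x i) (J : List ℕ) :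
    hallTest K (m, n, c, w) v X J = true ↔ ∃ T : Fin m → Fin m → Prop,
      IsStrictTotalOrder (Fin m) T ∧ (∀ a b, P a b → T a b) ∧
        ∀ i : Fin K, position T (x i) = J.getD i 0 + 1 := by
  classical
  have key : ∀ s e : ℕ, ((List.range m).filter fun a => (List.range m).all fun p =>
      !allowed K (m, n, c, w) v X J a p || (decide (s ≤ p) && decide (p < e))).length =
      (Finset.univ.filter fun a : Fin m => ∀ p < m, Fits P x (fun i => J.getD i 0) a p →
        s ≤ p ∧ p < e).card := by
    intro s e
    rw [length_filter_range]
    congr 1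
    ext a
    simp only [Finset.mem_filter_univ, List.all_eq_true, List.mem_range, Bool.or_eq_true,
      Bool.and_eq_true, Bool.not_eq_true', ← Bool.not_eq_true, allowed_iff hP hx,
      decide_eq_true_iff, ← imp_iff_not_or]
  rw [exists_linear_extension_iff hS, hallTest, Fintype.card_fin]
  simp only [List.all_eq_true, List.mem_range, Nat.lt_succ_iff, decide_eq_true_iff, key]

theorem scoreOrZero_eq (r : PositionalScoringRule) {j : ℕ} (h1 : 1 ≤ j) (h2 : j ≤ m) :
    r.scoreOrZero m j = r.score m j :=
  if_pos (by simp [h1, h2])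

/-- This is the invariant of the dynamic program: exactly the score vectors reachable by the first
`n'` votes are kept. Votes are completed independently, and a vote contributes only through the
positions of the `K` chosen candidates. Voters are indexed by natural numbers to make the induction
on their number direct. -/
theorem mem_foldl_nextTotals (r : PositionalScoringRule) (hm : 1 ≤ m)
    {P : ℕ → Fin m → Fin m → Prop} (hS : ∀ v, IsStrictOrder (Fin m) (P v))
    (hP : ∀ v < n, ∀ a b : Fin m, prefEntry (m, n, c, w) v a b = true ↔ P v a b)
    (hx : ∀ i : Fin K, X.getD i 0 = x i) (n' : ℕ) (hn : n' ≤ n) (t : List ℕ) :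
    t ∈ (List.range n').foldl (nextTotals r.scoreOrZero K (m, n, c, w) X)
      [List.replicate K 0] ↔
    t.length = K ∧ ∃ T : ℕ → Fin m → Fin m → Prop,
      (∀ v < n', IsStrictTotalOrder (Fin m) (T v) ∧ ∀ a b, P v a b → T v a b) ∧
      ∀ i : Fin K, t.getD i 0 = ∑ v ∈ Finset.range n', r.score m (position (T v) (x i)) := by
  have hpos : ∀ {T : Fin m → Fin m → Prop} (_ : IsStrictTotalOrder (Fin m) T) (a : Fin m),
      position T a ≤ m := fun hT a => (position_le_card hT a).trans (Fintype.card_fin m).le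
  induction n' generalizing t with
  | zero =>
    rw [List.range_zero, List.foldl_nil, List.mem_singleton]
    constructor
    · rintro rfl
      exact ⟨List.length_replicate, fun _ => (· < ·), fun v hv => absurd hv (Nat.not_lt_zero v),
        fun i => by simp⟩
    · rintro ⟨ht, T, -, h⟩
      refine List.eq_replicate_iff.2 ⟨ht, fun b hb => ?_⟩
      obtain ⟨i, hi, rfl⟩ := List.mem_iff_getElem.1 hb
      have := h ⟨i, ht ▸ hi⟩
      rwa [Finset.range_zero, Finset.sum_empty, List.getD_eq_getElem _ _ hi] at this
  | succ n' ih =>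
    have ih := fun t => ih (by omega) t
    rw [List.range_succ, List.foldl_append, List.foldl_cons, List.foldl_nil, nextTotals,
      List.mem_filter, List.any_eq_true]
    simp only [List.any_eq_true, Bool.and_eq_true, List.all_eq_true, List.mem_range,
      decide_eq_true_iff, ih, mem_tuples, hallTest_iff (hS n') (hP n' (by omega)) hx]
    constructor
    · rintro ⟨⟨ht, -⟩, s, ⟨-, T, hT, hs⟩, J, ⟨-, hJm⟩, ⟨U, hU, hPU, hUJ⟩, hts⟩
      refine ⟨ht, fun v => if v = n' then U else T v, fun v hv => ?_, fun i => ?_⟩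
      · rcases eq_or_ne v n' with rfl | hne
        · simpa using ⟨hU, hPU⟩
        · simpa [hne] using hT v (by omega)
      · have hJi := hJm i i.2
        rw [Finset.sum_range_succ, hts i i.2, hs i]
        dsimp only
        rw [if_pos rfl, hUJ, scoreOrZero_eq r (by omega) (by omega)]
        refine congrArg (· + _) (Finset.sum_congr rfl fun v hv => ?_)
        rw [if_neg (Finset.mem_range.1 hv).ne]
    · rintro ⟨ht, T, hT, h⟩
      -- The witnesses are the totals before the last vote and the positions in that vote, shifted
      -- by one because the algorithm counts positions from `0`.
      refine ⟨⟨ht, fun i hi => ?_⟩,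
        List.ofFn fun i => ∑ v ∈ Finset.range n', r.score m (position (T v) (x i)),
        ⟨by simp, T, fun v hv => hT v (by omega), fun i => getD_ofFn _ i⟩,
        List.ofFn fun i => position (T n') (x i) - 1, ⟨by simp, fun i hi => ?_⟩,
        ⟨T n', (hT n' (by omega)).1, (hT n' (by omega)).2, fun i => ?_⟩, fun i hi => ?_⟩
      -- Each vote gives at most the top score, so every total is within the range that the
      -- algorithm searches.
      · rw [h ⟨i, hi⟩, Nat.lt_succ_iff, scoreOrZero_eq r le_rfl hm]
        refine (Finset.sum_le_card_nsmul _ _ (r.score m 1) fun v hv => ?_).trans ?_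
        · exact r.antitone m 1 _ le_rfl (one_le_position _ _)
            (hpos (hT v (Finset.mem_range.1 hv)).1 _)
        · rw [Finset.card_range, smul_eq_mul]
          exact Nat.mul_le_mul_right _ hn
      · rw [getD_ofFn _ ⟨i, hi⟩]
        have h1 := hpos (hT n' (by omega)).1 (x ⟨i, hi⟩)
        have h2 := one_le_position (T n') (x ⟨i, hi⟩)
        omega
      · rw [getD_ofFn]
        have h2 := one_le_position (T n') (x i)
        omega
      · have h1 := hpos (hT n' (by omega)).1 (x ⟨i, hi⟩)
        have h2 := one_le_position (T n') (x ⟨i, hi⟩)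
        rw [getD_ofFn _ ⟨i, hi⟩, getD_ofFn _ ⟨i, hi⟩, h ⟨i, hi⟩, Finset.sum_range_succ,
          Nat.sub_add_cancel h2, scoreOrZero_eq r h2 h1]

end Correctness

theorem mem_totals (r : PositionalScoringRule) (I : Instance) {K : ℕ} {X : List ℕ}
    {x : Fin K → Fin I.m} (hx : ∀ i : Fin K, X.getD i 0 = x i) (t : List ℕ) :
    t ∈ totals r.scoreOrZero K (I.m, I.n, (I.c : ℕ), matrixBits I) X ↔
    t.length = K ∧ ∃ T : Fin I.n → Fin I.m → Fin I.m → Prop, Completes T I.profile ∧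
      ∀ i : Fin K, t.getD i 0 = totalScore r T (x i) := by
  -- Indices beyond the last voter receive the empty relation, which is still a strict order.
  have hS : ∀ v : ℕ, IsStrictOrder (Fin I.m)
      (fun a b => ∃ h : v < I.n, I.profile ⟨v, h⟩ a b) := by
    intro v
    by_cases hv : v < I.n
    · simpa [hv] using I.profile_order ⟨v, hv⟩
    · exact { irrefl := fun a h => hv h.1, trans := fun a b c h => absurd h.1 hv }
  have key := mem_foldl_nextTotals r (by have := I.c.2; omega) hS
    (fun v hv a b => (prefEntry_iff I ⟨v, hv⟩ a b).trans (by simp [hv])) hx I.n le_rfl t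
  rw [totals]
  refine key.trans (and_congr_right fun ht => ?_)
  simp only [totalScore, Fintype.card_fin]
  constructor
  · rintro ⟨T, hT, h⟩
    refine ⟨fun v => T v, fun v => ⟨(hT v v.2).1, fun a b hab => (hT v v.2).2 a b ⟨v.2, hab⟩⟩,
      fun i => ?_⟩
    rw [h i, Fin.sum_univ_eq_sum_range fun v => r.score I.m (position (T v) (x i))]
  · rintro ⟨T, hT, h⟩
    refine ⟨fun v a b => ∃ h : v < I.n, T ⟨v, h⟩ a b, fun v hv => ?_, fun i => ?_⟩
    · simpa [hv] using hT ⟨v, hv⟩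
    · rw [h i, ← Fin.sum_univ_eq_sum_range fun v =>
        r.score I.m (position (fun a b => ∃ h : v < I.n, T ⟨v, h⟩ a b) (x i))]
      simp

theorem distinct_iff {K m : ℕ} {X : List ℕ} {x : Fin K → Fin m} (hx : ∀ i : Fin K, X.getD i 0 = x i) :
    distinct K X = true ↔ Function.Injective x := by
  simp only [distinct, List.all_eq_true, List.mem_range, Bool.not_eq_true',
    decide_eq_false_iff_not]
  constructor
  · intro h i j hij
    by_contra hne
    rcases lt_or_gt_of_ne hne with hlt | hlt
    · exact h j j.2 i hlt (by rw [hx, hx, hij])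
    · exact h i i.2 j hlt (by rw [hx, hx, hij])
  · intro h i hi j hj hij
    have := h (Fin.ext ((hx ⟨i, hi⟩).symm.trans (hij.trans (hx ⟨j, hj.trans hi⟩))))
    simp only [Fin.mk.injEq] at this
    omega

theorem exists_injective_iff_le_ncard {C : Type} [Finite C] (s : Set C) (k : ℕ) :
    (∃ f : Fin k → C, Function.Injective f ∧ ∀ i, f i ∈ s) ↔ k ≤ s.ncard := by
  classical
  have := Fintype.ofFinite C
  constructor
  · rintro ⟨f, hf, hs⟩
    have := Set.ncard_le_ncard (Set.range_subset_iff.2 hs) (Set.toFinite s)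
    rwa [← Set.image_univ, Set.ncard_image_of_injective _ hf, Set.ncard_univ, Nat.card_fin] at this
  · intro h
    rw [← Nat.card_coe_set_eq, Nat.card_eq_fintype_card] at h
    obtain ⟨f⟩ := Function.Embedding.nonempty_of_card_le (α := Fin k) (β := s) (by simpa using h)
    exact ⟨fun i => f i, Subtype.val_injective.comp f.injective, fun i => (f i).2⟩

/-- The algorithm is correct. -/
theorem refuted_iff (r : PositionalScoringRule) (k : ℕ) (I : Instance) :
    refuted r.scoreOrZero k (readInstance (encodeInstance I)) = true ↔ ¬ NTW r k I := by
  rw [readInstance_encodeInstance]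
  have hbeaten : ∀ (T : Fin I.n → Fin I.m → Fin I.m → Prop) (D t : List ℕ) (d : Fin k → Fin I.m)
      (_ : ∀ i : Fin k, D.getD i 0 = d i)
      (_ : ∀ i : Fin (k + 1), t.getD i 0 =
        totalScore r T (Fin.cons (α := fun _ => Fin I.m) I.c d i)),
      beaten k (I.m, I.n, (I.c : ℕ), matrixBits I) ((I.c : ℕ) :: D) t = true ↔
        ∀ i, Beats r T I.tie (d i) I.c := by
    intro T D t d hd ht
    rw [beaten, List.all_eq_true]
    have h0 : t.getD 0 0 = totalScore r T I.c := ht 0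
    have key : ∀ i : Fin k, (decide (t.getD 0 0 < t.getD (i + 1) 0) ||
        (decide (t.getD 0 0 = t.getD (i + 1) 0) &&
          tieEntry (I.m, I.n, (I.c : ℕ), matrixBits I) (((I.c : ℕ) :: D).getD (i + 1) 0)
            (((I.c : ℕ) :: D).getD 0 0))) = true ↔ Beats r T I.tie (d i) I.c := by
      intro i
      have h1 : t.getD (i + 1) 0 = totalScore r T (d i) := ht i.succ
      have h2 : ((I.c : ℕ) :: D).getD (i + 1) 0 = d i := hd i
      rw [h0, h1, h2, List.getD_cons_zero, Bool.or_eq_true, Bool.and_eq_true, decide_eq_true_iff,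
        decide_eq_true_iff, tieEntry_iff, Beats, eq_comm (a := totalScore r T I.c)]
    exact ⟨fun h i => (key i).1 (h i (List.mem_range.2 i.2)),
      fun h i hi => (key ⟨i, List.mem_range.1 hi⟩).2 (h _)⟩
  have hcons : ∀ (D : List ℕ) (d : Fin k → Fin I.m), (∀ i : Fin k, D.getD i 0 = d i) →
      ∀ i : Fin (k + 1), ((I.c : ℕ) :: D).getD i 0 =
        (Fin.cons (α := fun _ => Fin I.m) I.c d i : Fin I.m) := by
    intro D d hd i
    refine Fin.cases rfl (fun i => ?_) i
    exact hd i
  -- The position of `c` is one more than the number of candidates that beat it, so it exceeds `k`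
  -- exactly when `k` distinct candidates beat `c`.
  have hNTW : ¬ NTW r k I ↔ ∃ T, Completes T I.profile ∧ ∃ d : Fin k → Fin I.m,
      Function.Injective d ∧ ∀ i, Beats r T I.tie (d i) I.c := by
    simp only [NTW, IsNecessaryTopKWinner, IsTopKWinner, not_forall, exists_prop]
    refine exists_congr fun T => and_congr_right fun _ => ?_
    rw [not_le, position, Nat.lt_succ_iff]
    exact (exists_injective_iff_le_ncard _ _).symm
  rw [hNTW, refuted]
  simp only [List.any_eq_true, Bool.and_eq_true, mem_tuples]
  constructor
  · rintro ⟨D, ⟨hD, hDm⟩, hdist, t, ht, hbeat⟩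
    have hd : ∀ i : Fin k, D.getD i 0 = ((⟨D.getD i 0, hDm i i.2⟩ : Fin I.m) : ℕ) := fun i => rfl
    obtain ⟨-, T, hT, hsum⟩ := (mem_totals r I (hcons D _ hd) t).1 ht
    exact ⟨T, hT, _, (distinct_iff hd).1 hdist, (hbeaten T D t _ hd hsum).1 hbeat⟩
  · rintro ⟨T, hT, d, hdinj, hbeat⟩
    have hd : ∀ i : Fin k, (List.ofFn fun i => (d i : ℕ)).getD i 0 = d i := getD_ofFn _
    have ht : ∀ i : Fin (k + 1), (List.ofFn fun i : Fin (k + 1) =>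
        totalScore r T (Fin.cons (α := fun _ => Fin I.m) I.c d i)).getD i 0 =
          totalScore r T (Fin.cons (α := fun _ => Fin I.m) I.c d i) := getD_ofFn _
    refine ⟨List.ofFn fun i => (d i : ℕ), ⟨by simp, fun i hi => ?_⟩, (distinct_iff hd).2 hdinj,
      _, (mem_totals r I (hcons _ _ hd) _).2 ⟨by simp, T, hT, ht⟩,
      (hbeaten T _ _ d hd ht).2 hbeat⟩
    rw [hd ⟨i, hi⟩]
    exact (d ⟨i, hi⟩).2

end TopKWinners

theorem mainTheorem5 (k : ℕ) (r : TopKWinners.PositionalScoringRule)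
    (hpoly : r.HasPolynomialScores) (hcomp : r.IsPolyTime) :
    TopKWinners.PolyTimeDecidable TopKWinners.encodeInstance (TopKWinners.NTW r k) := by
  obtain ⟨H, hfin⟩ := hcomp
  refine ⟨fun I => !TopKWinners.refuted r.scoreOrZero k
    (TopKWinners.readInstance (TopKWinners.encodeInstance I)), fun I => ?_, ?_⟩
  · rw [Bool.not_eq_true', ← Bool.not_eq_true, TopKWinners.refuted_iff, not_not]
  -- The oracle is the machine `H.tm` computing the scores; `hfin` makes its alphabets, and hence
  -- those of the compiled machine, finite.
  · exact (TopKWinners.PolyTime.readInstance.refuted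
      (TopKWinners.PolyTime.scoreOrZero r hpoly H) k).not.polyTimeComputable hfin
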